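/- Let $\mu$ be a Borel probability measure on $\mathbb{C}$. A sequence $(a_k)_{k\ge1}$ of complex numbers is called $\mu$-distributed if $\frac1n\sum_{k=1}^n\delta_{a_k}\to\mu$ weakly, and log-Cesàro-bounded if the sequence $\big(\frac1n\sum_{k=1}^n\log_+|a_k|\big)_{n\ge1}$ is bounded, where $\log_+ t=\max(0,\log t)$ and $\log_+0=0$. For a non-constant complex polynomial $P$ let $\mathscr{M}(P)$ be the uniform probability measure on the multiset of zeros of $P$ (zeros counted with multiplicity). Let $(a_k)_{k\ge1}$ and $(b_k)_{k\ge1}$ be two $\mu$-distributed and log-Cesàro-bounded sequences of complex numbers such that $a_k\ne b_k$ for infinitely many $k$. Let $\xi_1,\xi_2,\dots$ be independent random variables on a probability space such that $\xi_k$ has law $\frac12\delta_{a_k}+\frac12\delta_{b_k}$ for every $k$, and let $P_n(z)=\prod_{k=1}^n(z-\xi_k)$. Then, as $n\to\infty$, (i) $\mathscr{M}(P_n)\to\mu$ weakly, almost surely; (ii) $\mathscr{M}(P_n')\to\mu$ weakly in probability, that is, for every neighbourhood $N$ of $\mu$ in the space of Borel probability measures on $\mathbb{C}$ with the topology of weak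 convergence, $\lim_{n\to\infty}\Pr(\mathscr{M}(P_n')\in N)=1$. (Here $n\ge2$, so that $P_n'$ is non-constant.) -/

import Mathlib

open MeasureTheory ProbabilityTheory Filter Polynomial
open scoped Topology ENNReal

namespace CriticalPoints

/-- The normalised counting measure `(1/|s|) ∑_{z ∈ s} δ_z` of a multiset of complex numbers
(elements are counted with multiplicity). -/
noncomputable def countingAverage (s : Multiset ℂ) : Measure ℂ :=
  (s.card : ℝ≥0∞)⁻¹ • (s.map Measure.dirac).sum

theorem sum_dirac_univ (s : Multiset ℂ) :
    (s.map Measure.dirac).sum (Set.univ : Set ℂ) = (s.card : ℝ≥0∞) := by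
  induction s using Multiset.induction_on with
  | empty => simp
  | cons z s ih => simp [ih, add_comm]

theorem isProbabilityMeasure_countingAverage {s : Multiset ℂ} (hs : s ≠ 0) :
    IsProbabilityMeasure (countingAverage s) := by
  refine ⟨?_⟩
  rw [countingAverage, Measure.smul_apply, sum_dirac_univ, smul_eq_mul]
  exact ENNReal.inv_mul_cancel (by simpa using hs) (ENNReal.natCast_ne_top _)

/-- The uniform probability measure on a nonempty multiset of complex numbers.
The empty multiset carries no such measure; it is given the arbitrary value `δ_0`. -/
noncomputable def empiricalMeasure (s : Multiset ℂ) : ProbabilityMeasure ℂ :=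
  open Classical in
  if hs : s = 0 then ⟨Measure.dirac 0, inferInstance⟩
  else ⟨countingAverage s, isProbabilityMeasure_countingAverage hs⟩

/-- The uniform probability measure on the multiset of zeros of a complex polynomial. -/
noncomputable def zeroMeasure (p : ℂ[X]) : ProbabilityMeasure ℂ :=
  empiricalMeasure p.roots

/-- A sequence (indexed from `0`) is `μ`-distributed if the empirical measures of its first `n`
terms converge weakly to `μ`; the topology on `ProbabilityMeasure ℂ` is that of weak
convergence. -/
def IsDistributed (μ : ProbabilityMeasure ℂ) (a : ℕ → ℂ) : Prop :=
  Tendsto (fun n : ℕ => empiricalMeasure ((Multiset.range n).map a)) atTop (𝓝 μ)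

/-- A sequence is log-Cesàro-bounded if the Cesàro means of `log₊ |a k|` form a bounded
sequence. -/
def LogCesaroBounded (a : ℕ → ℂ) : Prop :=
  ∃ C : ℝ, ∀ n : ℕ, |(1 / (n : ℝ)) * ∑ k ∈ Finset.range n, Real.posLog ‖a k‖| ≤ C

/-- The monic polynomial whose zeros are the first `n` terms of the sequence `z`. -/
noncomputable def polyOfZeros (z : ℕ → ℂ) (n : ℕ) : ℂ[X] :=
  ∏ k ∈ Finset.range n, (X - C (z k))

end CriticalPoints

/-!
The zeros of `P_n` are handled by a law of large numbers; the critical points are compared with the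
zeros through the logarithmic potentials `U_n(z) = ∑ log |z - ξ_k|` and `U_n'(z) = ∑ log |z - η_i|`,
where `η_i` runs over the critical points of `P_n`. Off a countable set
`U_n'(z) - U_n(z) = log |S_n(z)| - log n`, where `S_n(z) = ∑ 1 / (z - ξ_k)` is the logarithmic
derivative `P_n' / P_n`. The proof shows that `(1/n) log |S_n| → 0` in probability at almost every
point, and that this forces the two empirical measures to have the same limit.

*Size of `S_n`.* For almost every `z` the terms `1 / (z - a_k)` and `1 / (z - b_k)` grow at most
linearly in `k` (Borel-Cantelli), so `|S_n(z)|` is at most polynomial. On the other hand `S_n(z)` is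
a sum of independent two-valued variables, infinitely many of which are not constant. Sperner's
theorem gives the Littlewood-Offord estimate `measure_abs_sum_lt_le`: each interval whose length is
small compared with the fluctuations of `2m` of these summands carries probability at most
`4^{-m} (2m choose m)`. Hence `|S_n(z)|` is exponentially small only with vanishing probability.

*From potentials to measures.* The function `bump δ` is a nonnegative continuous radial bump
supported in the disc of radius `3δ`. It is the logarithmic potential of the bounded compactly
supported density `bumpProfile δ ‖z‖`, because the mean of `log |z - w|` over the circle `|z| = s`
equals `log (max s |w|)`. Integrating `U_n' - U_n` against translates of this density therefore
compares the averages of translated bumps over critical points and over zeros. Almost everywhere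
convergence is upgraded to convergence in `L¹` on discs
(`tendsto_lintegral_enorm_logPotential_sub`): the singular parts of the potentials are uniformly
small in `L¹`, and the remaining parts are uniformly bounded, since the logarithmic means of the
zeros are bounded by hypothesis and those of the critical points by a weak form of Mahler's
inequality (`sum_posLog_roots_derivative_le`). Finally the averages of small bumps determine weak
convergence (`tendsto_of_tendsto_integral_bump`), by Fatou's lemma and the portmanteau theorem.

*Randomness.* Convergence in measure on the product of the probability space and the plane yields,
along a subsequence of any given sequence of degrees, almost sure convergence at almost every point,
to which the deterministic criterion `tendsto_zeroMeasure_derivative` applies. For the zeros, the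
same bumps are used as test functions, with a law of large numbers deduced from Hoeffding's
inequality.
-/

namespace CriticalPoints

/-! ### Logarithms in the plane -/

theorem complex_polarCoord_symm_eq_circleMap (p : ℝ × ℝ) :
    Complex.polarCoord.symm p = circleMap 0 p.1 p.2 := by
  rw [Complex.polarCoord_symm_apply, circleMap, Complex.exp_mul_I]
  simp

/-- Integration in polar coordinates of a radial function times an arbitrary function. -/
theorem integral_radial_mul {g : ℝ → ℝ} {f : ℂ → ℝ} (hm : Measurable fun z : ℂ => g ‖z‖ * f z)
    (hint : Integrable fun z : ℂ => g ‖z‖ * f z) :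
    ∫ z : ℂ, g ‖z‖ * f z
      = ∫ s in Set.Ioi (0 : ℝ), s * g s * (2 * Real.pi * Real.circleAverage f 0 s) := by
  have hcm : Measurable fun p : ℝ × ℝ => circleMap 0 p.1 p.2 := by
    unfold circleMap; fun_prop
  rw [← Complex.integral_comp_polarCoord_symm]
  have htarget : polarCoord.target = Set.Ioi (0 : ℝ) ×ˢ Set.Ioo (-Real.pi) Real.pi := rfl
  have hmeas : Measurable fun p : ℝ × ℝ =>
      p.1 • (g ‖Complex.polarCoord.symm p‖ * f (Complex.polarCoord.symm p)) := by
    simp only [complex_polarCoord_symm_eq_circleMap]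
    exact measurable_fst.smul (hm.comp hcm)
  have hInt : IntegrableOn (fun p : ℝ × ℝ =>
      p.1 • (g ‖Complex.polarCoord.symm p‖ * f (Complex.polarCoord.symm p)))
      polarCoord.target := by
    refine ⟨hmeas.aestronglyMeasurable, ?_⟩
    have h := hint.2
    rw [HasFiniteIntegral, ← Complex.lintegral_comp_polarCoord_symm] at h
    rw [HasFiniteIntegral]
    refine lt_of_le_of_lt (le_of_eq ?_) h
    refine setLIntegral_congr_fun (by rw [htarget]; measurability) fun p hp => ?_
    have hp0 : 0 < p.1 := hp.1
    simp only [smul_eq_mul]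
    rw [enorm_mul, Real.enorm_of_nonneg hp0.le]
  rw [htarget] at hInt ⊢
  rw [Measure.volume_eq_prod] at hInt ⊢
  rw [setIntegral_prod _ hInt]
  refine setIntegral_congr_fun measurableSet_Ioi fun s hs => ?_
  have hs0 : (0 : ℝ) < s := hs
  simp only [complex_polarCoord_symm_eq_circleMap, smul_eq_mul, norm_circleMap_zero,
    abs_of_pos hs0]
  rw [integral_const_mul, integral_const_mul, Real.circleAverage_def, smul_eq_mul]
  have hper : Function.Periodic (fun θ => f (circleMap 0 s θ)) (2 * Real.pi) := fun θ => by
    simp [periodic_circleMap 0 s θ]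
  have h1 := hper.intervalIntegral_add_eq (-Real.pi) 0
  rw [zero_add, show -Real.pi + 2 * Real.pi = Real.pi by ring] at h1
  rw [← h1, intervalIntegral.integral_of_le (by linarith [Real.pi_pos]),
    ← integral_Ioc_eq_integral_Ioo]
  have := Real.pi_pos.ne'
  field_simp

/-- The reciprocal of the norm is integrable over the unit disc. -/
theorem lintegral_ball_inv_norm_lt_top :
    ∫⁻ z in Metric.ball (0 : ℂ) 1, ENNReal.ofReal ‖z‖⁻¹ < ∞ := by
  rw [← lintegral_indicator Metric.isOpen_ball.measurableSet,
    ← Complex.lintegral_comp_polarCoord_symm]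
  have htarget : polarCoord.target = Set.Ioi (0 : ℝ) ×ˢ Set.Ioo (-Real.pi) Real.pi := rfl
  rw [htarget]
  calc ∫⁻ p in Set.Ioi (0 : ℝ) ×ˢ Set.Ioo (-Real.pi) Real.pi, ENNReal.ofReal p.1 •
        (Metric.ball (0 : ℂ) 1).indicator (fun z => ENNReal.ofReal ‖z‖⁻¹)
          (Complex.polarCoord.symm p)
      ≤ ∫⁻ p in Set.Ioi (0 : ℝ) ×ˢ Set.Ioo (-Real.pi) Real.pi,
        (Set.Ioo (0 : ℝ) 1 ×ˢ Set.Ioo (-Real.pi) Real.pi).indicator (fun _ => 1) p := by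
        refine setLIntegral_mono' (measurableSet_Ioi.prod measurableSet_Ioo) fun p hp => ?_
        have hp0 : 0 < p.1 := hp.1
        by_cases h1 : p.1 < 1
        · rw [Set.indicator_of_mem, Set.indicator_of_mem]
          · rw [Complex.norm_polarCoord_symm, abs_of_pos hp0, smul_eq_mul,
              ← ENNReal.ofReal_mul hp0.le, mul_inv_cancel₀ hp0.ne', ENNReal.ofReal_one]
          · exact ⟨⟨hp0, h1⟩, hp.2⟩
          · rw [mem_ball_zero_iff, Complex.norm_polarCoord_symm, abs_of_pos hp0]
            exact h1
        · rw [Set.indicator_of_notMem, smul_zero]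
          · exact zero_le
          · rw [mem_ball_zero_iff, Complex.norm_polarCoord_symm, abs_of_pos hp0]
            exact h1
    _ ≤ ∫⁻ p, (Set.Ioo (0 : ℝ) 1 ×ˢ Set.Ioo (-Real.pi) Real.pi).indicator (fun _ => 1) p :=
        setLIntegral_le_lintegral _ _
    _ < ∞ := by
        rw [lintegral_indicator (measurableSet_Ioo.prod measurableSet_Ioo)]
        simp only [lintegral_one, Measure.restrict_apply_univ]
        rw [Measure.volume_eq_prod, Measure.prod_prod]
        simp

/-- The mass of the logarithmic singularity below the scale `ε` is `O(ε)`, uniformly in its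
position. -/
theorem lintegral_posLog_div_norm_sub_le {ε : ℝ} (hε : 0 < ε) (hε1 : ε ≤ 1) (w : ℂ) :
    ∫⁻ z : ℂ, ENNReal.ofReal (Real.posLog (ε / ‖z - w‖))
      ≤ ENNReal.ofReal ε * ∫⁻ z in Metric.ball (0 : ℂ) 1, ENNReal.ofReal ‖z‖⁻¹ := by
  rw [lintegral_sub_right_eq_self (fun z : ℂ => ENNReal.ofReal (Real.posLog (ε / ‖z‖))) w,
    ← lintegral_const_mul _ (by fun_prop), ← lintegral_indicator Metric.isOpen_ball.measurableSet]
  refine lintegral_mono fun z => ?_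
  by_cases hz : ‖z‖ < 1
  · rw [Set.indicator_of_mem (by simpa using hz), ← ENNReal.ofReal_mul hε.le]
    refine ENNReal.ofReal_le_ofReal ?_
    rw [Real.posLog_apply, ← div_eq_mul_inv]
    have h0 : 0 ≤ ε / ‖z‖ := by positivity
    exact max_le h0 (Real.log_le_self h0)
  · rw [Set.indicator_of_notMem (by simpa using hz)]
    have : Real.posLog (ε / ‖z‖) = 0 := by
      rw [Real.posLog_eq_zero_iff, abs_of_nonneg (by positivity)]
      exact (div_le_one (by linarith)).2 (by linarith)
    simp [this]

/-- Truncation of the logarithm at the scale `ε`. -/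
theorem abs_log_le_posLog_add {ε : ℝ} (hε : 0 < ε) (t : ℝ) :
    |Real.log t| ≤ Real.posLog t + Real.posLog ε⁻¹ + Real.posLog (ε / t) := by
  have h1 : Real.posLog t⁻¹ ≤ Real.posLog ε⁻¹ + Real.posLog (ε / t) := by
    have := @Real.posLog_mul ε⁻¹ (ε / t)
    rwa [show ε⁻¹ * (ε / t) = t⁻¹ by field_simp] at this
  rw [← Real.posLog_sub_posLog_inv (x := t), abs_le]
  have h2 := @Real.posLog_nonneg t
  have h3 := @Real.posLog_nonneg t⁻¹
  constructor <;> linarith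

/-- On the disc of radius `R`, the logarithm `log ‖z - w‖` is a bounded function plus a function of
small integral. -/
theorem abs_log_norm_sub_le {ε R : ℝ} (hε : 0 < ε) {z : ℂ} (hz : ‖z‖ ≤ R) (w : ℂ) :
    |Real.log ‖z - w‖| ≤ (Real.posLog R + Real.log 2 + Real.posLog ε⁻¹ + Real.posLog ‖w‖)
      + Real.posLog (ε / ‖z - w‖) := by
  have h1 := abs_log_le_posLog_add hε ‖z - w‖
  have h2 := Real.posLog_norm_add_le z (-w)
  rw [← sub_eq_add_neg, norm_neg] at h2
  have h3 := Real.posLog_le_posLog (norm_nonneg z) hz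
  linarith

theorem integrableOn_ball_log_norm_sub (R : ℝ) (w : ℂ) :
    IntegrableOn (fun z : ℂ => Real.log ‖z - w‖) (Metric.ball 0 R) := by
  have hi : Integrable fun z : ℂ => Real.posLog (1 / ‖z - w‖) := by
    refine ⟨(by fun_prop : Measurable _).aestronglyMeasurable, ?_⟩
    rw [hasFiniteIntegral_iff_ofReal (ae_of_all _ fun z => Real.posLog_nonneg)]
    refine (lintegral_posLog_div_norm_sub_le one_pos le_rfl w).trans_lt ?_
    simpa using lintegral_ball_inv_norm_lt_top
  have hc : IntegrableOn (fun _ : ℂ => Real.posLog R + Real.log 2 + Real.posLog 1⁻¹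
      + Real.posLog ‖w‖) (Metric.ball 0 R) :=
    integrableOn_const Metric.isBounded_ball.measure_lt_top.ne
  refine (hc.add hi.integrableOn).mono' (by fun_prop : Measurable _).aestronglyMeasurable ?_
  filter_upwards [ae_restrict_mem Metric.isOpen_ball.measurableSet] with z hz
  exact abs_log_norm_sub_le one_pos (by simpa using (mem_ball_zero_iff.1 hz).le) w

/-! ### Radial bumps that are logarithmic potentials -/

/-- The radial profile `-1/s` on `(δ, 2δ]`, `1/s` on `(2δ, 3δ]`. The factor `1/s` cancels the
Jacobian of polar coordinates, so that `bumpProfile δ ‖z‖` is the density of a signed measure of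
total mass zero. -/
noncomputable def bumpProfile (δ s : ℝ) : ℝ :=
  (Set.Ioc (2 * δ) (3 * δ)).indicator (fun s => s⁻¹) s
    - (Set.Ioc δ (2 * δ)).indicator (fun s => s⁻¹) s

/-- The logarithmic potential of the radial density `bumpProfile δ ‖z‖`, written out by means of the
circle averages `log (max s ‖w‖)` of `log ‖z - w‖` over `‖z‖ = s`; see
`integral_bumpProfile_mul_log`. -/
noncomputable def bump (δ : ℝ) (w : ℂ) : ℝ :=
  2 * Real.pi * ∫ s in δ..2 * δ, (Real.log (max (s + δ) ‖w‖) - Real.log (max s ‖w‖))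

theorem measurable_bumpProfile (δ : ℝ) : Measurable (bumpProfile δ) := by
  unfold bumpProfile
  exact (measurable_inv.indicator measurableSet_Ioc).sub
    (measurable_inv.indicator measurableSet_Ioc)

theorem bumpProfile_eq_zero {δ s : ℝ} (hδ : 0 < δ) (hs : 3 * δ < s) : bumpProfile δ s = 0 := by
  unfold bumpProfile
  rw [Set.indicator_of_notMem (fun h => absurd h.2 (by linarith)),
    Set.indicator_of_notMem (fun h => absurd h.2 (by linarith)), sub_zero]

theorem abs_bumpProfile_le {δ : ℝ} (hδ : 0 < δ) (s : ℝ) : |bumpProfile δ s| ≤ 2 * δ⁻¹ := by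
  have key : ∀ a b : ℝ, δ ≤ a → |(Set.Ioc a b).indicator (fun s : ℝ => s⁻¹) s| ≤ δ⁻¹ := by
    intro a b ha
    by_cases h : s ∈ Set.Ioc a b
    · rw [Set.indicator_of_mem h, abs_of_pos (inv_pos.2 (by linarith [h.1]))]
      exact inv_anti₀ hδ (by linarith [h.1])
    · rw [Set.indicator_of_notMem h, abs_zero]
      positivity
  unfold bumpProfile
  have h1 := key (2 * δ) (3 * δ) (by linarith)
  have h2 := key δ (2 * δ) le_rfl
  have h3 := abs_sub ((Set.Ioc (2 * δ) (3 * δ)).indicator (fun s : ℝ => s⁻¹) s)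
    ((Set.Ioc δ (2 * δ)).indicator (fun s : ℝ => s⁻¹) s)
  linarith

theorem integrable_bumpProfile_mul {δ : ℝ} (hδ : 0 < δ) (w : ℂ) :
    Integrable fun z : ℂ => bumpProfile δ ‖z‖ * Real.log ‖z - w‖ := by
  have h : IntegrableOn (fun z : ℂ => bumpProfile δ ‖z‖ * Real.log ‖z - w‖)
      (Metric.ball 0 (4 * δ)) := by
    refine (integrableOn_ball_log_norm_sub (4 * δ) w).bdd_mul (c := 2 * δ⁻¹)
      ((measurable_bumpProfile δ).comp measurable_norm).aestronglyMeasurable ?_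
    exact ae_of_all _ fun z => abs_bumpProfile_le hδ _
  refine (integrableOn_iff_integrable_of_support_subset ?_).1 h
  intro z hz
  by_contra hz'
  refine hz ?_
  rw [mem_ball_zero_iff, not_lt] at hz'
  simp only
  rw [bumpProfile_eq_zero hδ (by linarith), zero_mul]

theorem log_add_posLog_inv_mul {s ρ : ℝ} (hs : 0 < s) (hρ : 0 ≤ ρ) :
    Real.log s + Real.posLog (s⁻¹ * ρ) = Real.log (max s ρ) := by
  rw [Real.posLog_eq_log_max_one (by positivity), ← Real.log_mul hs.ne' (by positivity),
    mul_max_of_nonneg _ _ hs.le, mul_one, mul_inv_cancel_left₀ hs.ne']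

theorem integral_bumpProfile_mul_log {δ : ℝ} (hδ : 0 < δ) (w : ℂ) :
    ∫ z : ℂ, bumpProfile δ ‖z‖ * Real.log ‖z - w‖ = bump δ w := by
  rw [integral_radial_mul (g := bumpProfile δ) (f := fun z => Real.log ‖z - w‖) _
    (integrable_bumpProfile_mul hδ w)]
  swap
  · exact ((measurable_bumpProfile δ).comp measurable_norm).mul (by fun_prop)
  have hcont : ∀ a b : ℝ, 0 < a → a ≤ b →
      IntegrableOn (fun s : ℝ => Real.log (max s ‖w‖)) (Set.Ioc a b) := by
    intro a b ha hab
    refine (ContinuousOn.integrableOn_Icc ?_).mono_set Set.Ioc_subset_Icc_self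
    refine ContinuousOn.log (by fun_prop) fun s hs => ?_
    exact (lt_of_lt_of_le ha (hs.1.trans (le_max_left _ _))).ne'
  have hI1 := hcont (2 * δ) (3 * δ) (by linarith) (by linarith)
  have hI2 := hcont δ (2 * δ) hδ (by linarith)
  calc ∫ s in Set.Ioi (0 : ℝ), s * bumpProfile δ s *
        (2 * Real.pi * Real.circleAverage (fun z => Real.log ‖z - w‖) 0 s)
      = ∫ s in Set.Ioi (0 : ℝ), 2 * Real.pi *
        ((Set.Ioc (2 * δ) (3 * δ)).indicator (fun s => Real.log (max s ‖w‖)) s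
          - (Set.Ioc δ (2 * δ)).indicator (fun s => Real.log (max s ‖w‖)) s) := by
        refine setIntegral_congr_fun measurableSet_Ioi fun s hs => ?_
        have hs0 : (0 : ℝ) < s := hs
        rw [circleAverage_log_norm_sub_const_eq_log_radius_add_posLog hs0.ne', zero_sub, norm_neg,
          log_add_posLog_inv_mul hs0 (norm_nonneg w), bumpProfile]
        by_cases h1 : s ∈ Set.Ioc (2 * δ) (3 * δ) <;> by_cases h2 : s ∈ Set.Ioc δ (2 * δ) <;>
          simp only [h1, h2, Set.indicator_of_mem, Set.indicator_of_notMem, not_false_eq_true,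
            sub_zero, zero_sub, mul_zero, zero_mul, mul_neg, neg_mul, sub_self,
            mul_inv_cancel₀ hs0.ne', one_mul]
    _ = bump δ w := by
        rw [integral_const_mul, integral_sub, integral_indicator measurableSet_Ioc,
          integral_indicator measurableSet_Ioc, Measure.restrict_restrict measurableSet_Ioc,
          Measure.restrict_restrict measurableSet_Ioc,
          Set.inter_eq_left.2 (fun s (hs : s ∈ Set.Ioc (2 * δ) (3 * δ)) =>
            Set.mem_Ioi.2 (lt_trans (by linarith) hs.1)),
          Set.inter_eq_left.2 (fun s (hs : s ∈ Set.Ioc δ (2 * δ)) =>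
            Set.mem_Ioi.2 (lt_trans hδ hs.1)), bump,
          intervalIntegral.integral_sub,
          intervalIntegral.integral_comp_add_right (fun s => Real.log (max s ‖w‖)),
          intervalIntegral.integral_of_le (by linarith),
          intervalIntegral.integral_of_le (by linarith)]
        · congr 4
          ring_nf
        · refine ContinuousOn.intervalIntegrable ?_
          rw [Set.uIcc_of_le (by linarith)]
          refine ContinuousOn.log (by fun_prop) fun s hs => ?_
          exact (lt_of_lt_of_le (by linarith [hs.1]) (le_max_left _ _)).ne'
        · rw [intervalIntegrable_iff_integrableOn_Ioc_of_le (by linarith)]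
          exact hI2
        · exact (hI1.integrable_indicator measurableSet_Ioc).integrableOn
        · exact (hI2.integrable_indicator measurableSet_Ioc).integrableOn

theorem continuous_bump {δ : ℝ} (hδ : 0 < δ) : Continuous (bump δ) := by
  have h : bump δ = fun w => 2 * Real.pi * ∫ s in δ..2 * δ,
      (Real.log (max (max s δ + δ) ‖w‖) - Real.log (max (max s δ) ‖w‖)) := by
    funext w
    unfold bump
    congr 1
    refine intervalIntegral.integral_congr fun s hs => ?_
    rw [Set.uIcc_of_le (by linarith)] at hs
    simp only [max_eq_left hs.1]
  rw [h]
  refine continuous_const.mul ?_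
  refine intervalIntegral.continuous_parametric_intervalIntegral_of_continuous' ?_ _ _
  unfold Function.uncurry
  refine Continuous.sub (Continuous.log (by fun_prop) fun p => ?_)
    (Continuous.log (by fun_prop) fun p => ?_)
  · have := le_max_left (max p.2 δ + δ) ‖p.1‖
    have := le_max_right p.2 δ
    exact ne_of_gt (by linarith)
  · have := le_max_left (max p.2 δ) ‖p.1‖
    have := le_max_right p.2 δ
    exact ne_of_gt (by linarith)

theorem bump_nonneg {δ : ℝ} (hδ : 0 < δ) (w : ℂ) : 0 ≤ bump δ w := by
  refine mul_nonneg (by positivity) (intervalIntegral.integral_nonneg (by linarith) fun s hs => ?_)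
  refine sub_nonneg.2 (Real.log_le_log (lt_of_lt_of_le (by linarith [hs.1]) (le_max_left _ _)) ?_)
  exact max_le_max (by linarith) le_rfl

theorem bump_eq_zero {δ : ℝ} (hδ : 0 < δ) {w : ℂ} (hw : 3 * δ ≤ ‖w‖) : bump δ w = 0 := by
  unfold bump
  rw [intervalIntegral.integral_congr (g := fun _ => 0), intervalIntegral.integral_zero, mul_zero]
  intro s hs
  rw [Set.uIcc_of_le (by linarith)] at hs
  simp only
  rw [max_eq_right (by linarith [hs.2]), max_eq_right (by linarith [hs.2]), sub_self]

theorem bump_zero_pos {δ : ℝ} (hδ : 0 < δ) : 0 < bump δ 0 := by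
  refine mul_pos (by positivity) ?_
  refine intervalIntegral.intervalIntegral_pos_of_pos_on ?_ (fun s hs => ?_) (by linarith)
  · refine ContinuousOn.intervalIntegrable ?_
    rw [Set.uIcc_of_le (by linarith)]
    refine ContinuousOn.sub (ContinuousOn.log (by fun_prop) fun s hs => ?_)
      (ContinuousOn.log (by fun_prop) fun s hs => ?_)
    · exact (lt_of_lt_of_le (by linarith [hs.1]) (le_max_left _ _)).ne'
    · exact (lt_of_lt_of_le (by linarith [hs.1]) (le_max_left _ _)).ne'
  · have hs0 : 0 < s := by linarith [hs.1]
    rw [norm_zero, max_eq_left (by linarith), max_eq_left hs0.le]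
    exact sub_pos.2 (Real.log_lt_log hs0 (by linarith))

theorem exists_forall_bump_le {δ : ℝ} (hδ : 0 < δ) : ∃ K, ∀ w, bump δ w ≤ K := by
  obtain ⟨K, hK⟩ := (isCompact_closedBall (0 : ℂ) (3 * δ)).bddAbove_image
    (continuous_bump hδ).continuousOn
  refine ⟨max K 0, fun w => ?_⟩
  by_cases hw : 3 * δ ≤ ‖w‖
  · rw [bump_eq_zero hδ hw]
    exact le_max_right _ _
  · refine le_trans (hK ⟨w, ?_, rfl⟩) (le_max_left _ _)
    simpa using (not_le.1 hw).le

/-! ### Weak convergence tested on bumps -/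

/-- The total mass of a bump. -/
noncomputable def bumpMass (δ : ℝ) : ℝ≥0∞ := ∫⁻ c : ℂ, ENNReal.ofReal (bump δ c)

theorem bumpMass_pos {δ : ℝ} (hδ : 0 < δ) : 0 < bumpMass δ := by
  have hc : Continuous fun c : ℂ => ENNReal.ofReal (bump δ c) :=
    ENNReal.continuous_ofReal.comp (continuous_bump hδ)
  rw [bumpMass, lintegral_pos_iff_support hc.measurable]
  refine IsOpen.measure_pos _ hc.isOpen_support ⟨0, ?_⟩
  simpa using bump_zero_pos hδ

theorem bumpMass_lt_top {δ : ℝ} (hδ : 0 < δ) : bumpMass δ < ∞ := by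
  obtain ⟨K, hK⟩ := exists_forall_bump_le hδ
  calc bumpMass δ ≤ ∫⁻ c : ℂ, (Metric.ball (0 : ℂ) (3 * δ)).indicator
        (fun _ => ENNReal.ofReal K) c := by
        refine lintegral_mono fun c => ?_
        by_cases hc : ‖c‖ < 3 * δ
        · rw [Set.indicator_of_mem (by simpa using hc)]
          exact ENNReal.ofReal_le_ofReal (hK c)
        · rw [bump_eq_zero hδ (not_lt.1 hc), ENNReal.ofReal_zero]
          exact zero_le
    _ < ∞ := by
        rw [lintegral_indicator Metric.isOpen_ball.measurableSet, setLIntegral_const]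
        exact ENNReal.mul_lt_top ENNReal.ofReal_lt_top Metric.isBounded_ball.measure_lt_top

theorem lintegral_bump_sub_left (δ : ℝ) (w : ℂ) :
    ∫⁻ c : ℂ, ENNReal.ofReal (bump δ (w - c)) = bumpMass δ :=
  lintegral_sub_left_eq_self (fun c : ℂ => ENNReal.ofReal (bump δ c)) w

theorem measurable_ofReal_bump_sub {δ : ℝ} (hδ : 0 < δ) :
    Measurable fun p : ℂ × ℂ => ENNReal.ofReal (bump δ (p.2 - p.1)) :=
  (ENNReal.continuous_ofReal.comp
    ((continuous_bump hδ).comp (continuous_snd.sub continuous_fst))).measurable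

/-- Smoothing a measure by `bump δ` moves mass by at most `3δ`: upper bound. -/
theorem setLIntegral_lintegral_bump_le {δ : ℝ} (hδ : 0 < δ) (ν : Measure ℂ) [IsProbabilityMeasure ν]
    {U : Set ℂ} (hU : IsOpen U) :
    ∫⁻ c in (Metric.thickening (3 * δ) Uᶜ)ᶜ, ∫⁻ w, ENNReal.ofReal (bump δ (w - c)) ∂ν
      ≤ bumpMass δ * ν U := by
  rw [lintegral_lintegral_swap (measurable_ofReal_bump_sub hδ).aemeasurable,
    ← setLIntegral_const, ← lintegral_indicator hU.measurableSet]
  refine lintegral_mono fun w => ?_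
  by_cases hw : w ∈ U
  · rw [Set.indicator_of_mem hw]
    exact (setLIntegral_le_lintegral _ _).trans (lintegral_bump_sub_left δ w).le
  · rw [Set.indicator_of_notMem hw]
    refine le_of_eq (setLIntegral_eq_zero Metric.isOpen_thickening.isClosed_compl.measurableSet ?_)
    intro c hc
    have : 3 * δ ≤ ‖w - c‖ := by
      by_contra! h
      exact hc (Metric.mem_thickening_iff.2 ⟨w, hw, by rwa [dist_comm, dist_eq_norm]⟩)
    simp [bump_eq_zero hδ this]

/-- Smoothing a measure by `bump δ` moves mass by at most `3δ`: lower bound. -/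
theorem le_setLIntegral_lintegral_bump {δ : ℝ} (hδ : 0 < δ) (ν : Measure ℂ) [IsProbabilityMeasure ν]
    (U : Set ℂ) :
    bumpMass δ * ν (Metric.thickening (6 * δ) Uᶜ)ᶜ
      ≤ ∫⁻ c in (Metric.thickening (3 * δ) Uᶜ)ᶜ, ∫⁻ w, ENNReal.ofReal (bump δ (w - c)) ∂ν := by
  have hVm : MeasurableSet (Metric.thickening (3 * δ) Uᶜ)ᶜ :=
    Metric.isOpen_thickening.isClosed_compl.measurableSet
  rw [lintegral_lintegral_swap (measurable_ofReal_bump_sub hδ).aemeasurable,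
    ← setLIntegral_const,
    ← lintegral_indicator Metric.isOpen_thickening.isClosed_compl.measurableSet]
  refine lintegral_mono fun w => ?_
  by_cases hw : w ∈ (Metric.thickening (6 * δ) Uᶜ)ᶜ
  · rw [Set.indicator_of_mem hw, ← lintegral_bump_sub_left δ w, ← lintegral_indicator hVm]
    refine lintegral_mono fun c => ?_
    by_cases hc : c ∈ (Metric.thickening (3 * δ) Uᶜ)ᶜ
    · rw [Set.indicator_of_mem hc]
    · rw [Set.indicator_of_notMem hc]
      obtain ⟨x, hx, hcx⟩ := Metric.mem_thickening_iff.1 (not_not.1 hc)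
      have : 3 * δ ≤ ‖w - c‖ := by
        by_contra! h
        refine hw (Metric.mem_thickening_iff.2 ⟨x, hx, ?_⟩)
        have := dist_triangle w c x
        rw [dist_eq_norm w c] at this
        linarith
      simp [bump_eq_zero hδ this]
  · rw [Set.indicator_of_notMem hw]
    exact zero_le

theorem integrable_bump_sub {δ : ℝ} (hδ : 0 < δ) (ν : Measure ℂ) [IsFiniteMeasure ν] (c : ℂ) :
    Integrable (fun w => bump δ (w - c)) ν := by
  obtain ⟨K, hK⟩ := exists_forall_bump_le hδ
  refine Integrable.of_bound
    ((continuous_bump hδ).comp (continuous_id.sub continuous_const)).aestronglyMeasurable K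
    (ae_of_all _ fun w => ?_)
  rw [Real.norm_of_nonneg (bump_nonneg hδ _)]
  exact hK _

/-- Weak convergence of probability measures follows from the convergence of the integrals of
almost all translates of small bumps: by Fatou's lemma, no mass of an open set is lost in the
limit. -/
theorem tendsto_of_tendsto_integral_bump {ν : ℕ → ProbabilityMeasure ℂ} {μ : ProbabilityMeasure ℂ}
    (h : ∀ m : ℕ, ∀ᵐ c : ℂ, Tendsto
      (fun j => ∫ w, bump (1 / ((m : ℝ) + 1)) (w - c) ∂(ν j : Measure ℂ)) atTop
      (𝓝 (∫ w, bump (1 / ((m : ℝ) + 1)) (w - c) ∂(μ : Measure ℂ)))) :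
    Tendsto ν atTop (𝓝 μ) := by
  refine tendsto_of_forall_isOpen_le_liminf' fun U hU => ?_
  have step : ∀ m : ℕ, (μ : Measure ℂ) (Metric.thickening (6 * (1 / ((m : ℝ) + 1))) Uᶜ)ᶜ
      ≤ liminf (fun j => (ν j : Measure ℂ) U) atTop := by
    intro m
    have hδ : (0 : ℝ) < 1 / ((m : ℝ) + 1) := by positivity
    have hm := h m
    set δ : ℝ := 1 / ((m : ℝ) + 1)
    rw [← ENNReal.mul_le_mul_iff_right (bumpMass_pos hδ).ne' (bumpMass_lt_top hδ).ne]
    have hof : ∀ (ν : ProbabilityMeasure ℂ) (c : ℂ),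
        ∫⁻ w, ENNReal.ofReal (bump δ (w - c)) ∂(ν : Measure ℂ)
          = ENNReal.ofReal (∫ w, bump δ (w - c) ∂(ν : Measure ℂ)) := fun ν c =>
      (ofReal_integral_eq_lintegral_ofReal (integrable_bump_sub hδ _ c)
        (ae_of_all _ fun w => bump_nonneg hδ _)).symm
    calc bumpMass δ * (μ : Measure ℂ) (Metric.thickening (6 * δ) Uᶜ)ᶜ
        ≤ ∫⁻ c in (Metric.thickening (3 * δ) Uᶜ)ᶜ,
            ∫⁻ w, ENNReal.ofReal (bump δ (w - c)) ∂(μ : Measure ℂ) :=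
          le_setLIntegral_lintegral_bump hδ _ U
      _ = ∫⁻ c in (Metric.thickening (3 * δ) Uᶜ)ᶜ,
            liminf (fun j => ∫⁻ w, ENNReal.ofReal (bump δ (w - c)) ∂(ν j : Measure ℂ)) atTop := by
          refine lintegral_congr_ae (ae_restrict_of_ae ?_)
          filter_upwards [hm] with c hc
          simp only [hof]
          exact ((ENNReal.continuous_ofReal.tendsto _).comp hc).liminf_eq.symm
      _ ≤ liminf (fun j => ∫⁻ c in (Metric.thickening (3 * δ) Uᶜ)ᶜ,
            ∫⁻ w, ENNReal.ofReal (bump δ (w - c)) ∂(ν j : Measure ℂ)) atTop :=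
          lintegral_liminf_le fun j => (measurable_ofReal_bump_sub hδ).lintegral_prod_right'
      _ ≤ liminf (fun j => bumpMass δ * (ν j : Measure ℂ) U) atTop :=
          liminf_le_liminf (Eventually.of_forall fun j => setLIntegral_lintegral_bump_le hδ _ hU)
      _ = bumpMass δ * liminf (fun j => (ν j : Measure ℂ) U) atTop :=
          ENNReal.liminf_const_mul_of_ne_top (bumpMass_lt_top hδ).ne
  have hlim : Tendsto (fun m : ℕ => (μ : Measure ℂ)
      (Metric.thickening (6 * (1 / ((m : ℝ) + 1))) Uᶜ)ᶜ) atTop (𝓝 ((μ : Measure ℂ) U)) := by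
    have h6 : Tendsto (fun m : ℕ => 6 * (1 / ((m : ℝ) + 1))) atTop (𝓝[>] 0) := by
      refine tendsto_nhdsWithin_iff.2 ⟨?_, Eventually.of_forall fun m => ?_⟩
      · simpa using tendsto_one_div_add_atTop_nhds_zero_nat.const_mul (6 : ℝ)
      · exact Set.mem_Ioi.2 (by positivity)
    have h1 := (tendsto_measure_thickening_of_isClosed (μ := (μ : Measure ℂ))
      ⟨1, one_pos, measure_ne_top _ _⟩ hU.isClosed_compl).comp h6
    have h2 := ENNReal.Tendsto.sub (tendsto_const_nhds (x := (1 : ℝ≥0∞))) h1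
      (Or.inl ENNReal.one_ne_top)
    simp only [Function.comp_apply] at h2
    convert h2 using 2
    · rw [prob_compl_eq_one_sub Metric.isOpen_thickening.measurableSet]
    · rw [← prob_compl_eq_one_sub hU.isClosed_compl.measurableSet, compl_compl]
  exact le_of_tendsto' hlim step

/-! ### Logarithmic potentials of finite multisets -/

/-- The (unnormalised) logarithmic potential `∑_{w ∈ s} log ‖z - w‖` of a multiset of points. -/
noncomputable def logPotential (s : Multiset ℂ) (z : ℂ) : ℝ :=
  (s.map fun w => Real.log ‖z - w‖).sum

theorem logPotential_cons (w : ℂ) (s : Multiset ℂ) (z : ℂ) :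
    logPotential (w ::ₘ s) z = Real.log ‖z - w‖ + logPotential s z := by
  simp [logPotential]

theorem measurable_logPotential (s : Multiset ℂ) : Measurable (logPotential s) := by
  induction s using Multiset.induction_on with
  | empty =>
    have h : logPotential 0 = fun _ => 0 := funext fun z => by simp [logPotential]
    rw [h]
    exact measurable_const
  | cons w s ih =>
    simp only [funext (logPotential_cons w s)]
    exact (by fun_prop : Measurable fun z : ℂ => Real.log ‖z - w‖).add ih

theorem log_norm_eval_eq {p : ℂ[X]} {z : ℂ} (hz : p.eval z ≠ 0) :
    Real.log ‖p.eval z‖ = Real.log ‖p.leadingCoeff‖ + logPotential p.roots z := by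
  have hp : p ≠ 0 := by
    rintro rfl
    simp at hz
  have h := congrArg (eval z) (IsAlgClosed.splits p).eq_prod_roots
  have hprod : (p.roots.map fun w => ‖z - w‖).prod ≠ 0 := by
    intro h0
    rw [Multiset.prod_eq_zero_iff, Multiset.mem_map] at h0
    obtain ⟨w, hw, hw0⟩ := h0
    rw [norm_eq_zero, sub_eq_zero] at hw0
    exact hz (hw0 ▸ (mem_roots hp).1 hw)
  have hnorm : ‖p.eval z‖ = ‖p.leadingCoeff‖ * (p.roots.map fun w => ‖z - w‖).prod := by
    rw [h, eval_mul, eval_C, norm_mul, eval_multiset_prod, Multiset.map_map]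
    congr 1
    refine (map_multiset_prod (normHom (α := ℂ)) _).trans ?_
    rw [Multiset.map_map]
    simp
  rw [hnorm, Real.log_mul (by simpa using hp) hprod, logPotential, Real.log_multiset_prod]
  · rw [Multiset.map_map]
    rfl
  · intro x hx h0
    exact hprod (Multiset.prod_eq_zero (h0 ▸ hx))

theorem abs_logPotential_le {ε R : ℝ} (hε : 0 < ε) {z : ℂ} (hz : ‖z‖ ≤ R) (s : Multiset ℂ) :
    |logPotential s z| ≤ (s.card * (Real.posLog R + Real.log 2 + Real.posLog ε⁻¹)
      + (s.map fun w => Real.posLog ‖w‖).sum)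
      + (s.map fun w => Real.posLog (ε / ‖z - w‖)).sum := by
  induction s using Multiset.induction_on with
  | empty => simp [logPotential]
  | cons w s ih =>
    rw [logPotential_cons]
    simp only [Multiset.map_cons, Multiset.sum_cons, Multiset.card_cons, Nat.cast_add, Nat.cast_one]
    have h1 := abs_log_norm_sub_le hε hz w
    have h2 := abs_add_le (Real.log ‖z - w‖) (logPotential s z)
    linarith

theorem measurable_sum_posLog_div (ε : ℝ) (s : Multiset ℂ) :
    Measurable fun z : ℂ => (s.map fun w => Real.posLog (ε / ‖z - w‖)).sum := by
  induction s using Multiset.induction_on with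
  | empty => simp
  | cons w s ih =>
    simp only [Multiset.map_cons, Multiset.sum_cons]
    exact (by fun_prop : Measurable fun z : ℂ => Real.posLog (ε / ‖z - w‖)).add ih

theorem lintegral_sum_posLog_div_le {ε : ℝ} (hε : 0 < ε) (hε1 : ε ≤ 1) (s : Multiset ℂ) :
    ∫⁻ z : ℂ, ENNReal.ofReal (s.map fun w => Real.posLog (ε / ‖z - w‖)).sum
      ≤ s.card * (ENNReal.ofReal ε *
        ∫⁻ z in Metric.ball (0 : ℂ) 1, ENNReal.ofReal ‖z‖⁻¹) := by
  induction s using Multiset.induction_on with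
  | empty => simp
  | cons w s ih =>
    simp only [Multiset.map_cons, Multiset.sum_cons, Multiset.card_cons, Nat.cast_add, Nat.cast_one]
    rw [add_comm (s.card : ℝ≥0∞), add_mul, one_mul]
    refine le_trans (lintegral_mono fun z => ENNReal.ofReal_add_le) ?_
    rw [lintegral_add_left (by fun_prop)]
    exact add_le_add (lintegral_posLog_div_norm_sub_le hε hε1 w) ih

theorem integrable_bumpProfile_mul_log_translate {δ : ℝ} (hδ : 0 < δ) (c w : ℂ) :
    Integrable fun z : ℂ => bumpProfile δ ‖z - c‖ * Real.log ‖z - w‖ := by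
  have h := (integrable_bumpProfile_mul hδ (w - c)).comp_sub_right c
  simpa [sub_sub_sub_cancel_right] using h

theorem integral_bumpProfile_mul_log_translate {δ : ℝ} (hδ : 0 < δ) (c w : ℂ) :
    ∫ z : ℂ, bumpProfile δ ‖z - c‖ * Real.log ‖z - w‖ = bump δ (w - c) := by
  rw [← integral_bumpProfile_mul_log hδ,
    ← integral_sub_right_eq_self (fun z => bumpProfile δ ‖z‖ * Real.log ‖z - (w - c)‖) c]
  simp [sub_sub_sub_cancel_right]

theorem integrable_bumpProfile_mul_logPotential {δ : ℝ} (hδ : 0 < δ) (c : ℂ) (s : Multiset ℂ) :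
    Integrable fun z : ℂ => bumpProfile δ ‖z - c‖ * logPotential s z := by
  induction s using Multiset.induction_on with
  | empty => simp [logPotential]
  | cons w s ih =>
    simp only [logPotential_cons, mul_add]
    exact (integrable_bumpProfile_mul_log_translate hδ c w).add ih

theorem integral_bumpProfile_mul_logPotential {δ : ℝ} (hδ : 0 < δ) (c : ℂ) (s : Multiset ℂ) :
    ∫ z : ℂ, bumpProfile δ ‖z - c‖ * logPotential s z = (s.map fun w => bump δ (w - c)).sum := by
  induction s using Multiset.induction_on with
  | empty => simp [logPotential]
  | cons w s ih =>
    simp only [logPotential_cons, mul_add, Multiset.map_cons, Multiset.sum_cons]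
    rw [integral_add (integrable_bumpProfile_mul_log_translate hδ c w)
      (integrable_bumpProfile_mul_logPotential hδ c s), ih,
      integral_bumpProfile_mul_log_translate hδ]

/-! ### From pointwise convergence of potentials to convergence of bump averages -/

/-- A form of Vitali's theorem: almost everywhere convergence to zero on a finite measure space
gives convergence in mean as soon as the functions are, up to an arbitrarily small error in mean,
uniformly bounded. -/
theorem tendsto_lintegral_enorm_of_le_add {α : Type*} [MeasurableSpace α] {m : Measure α}
    [IsFiniteMeasure m] {f : ℕ → α → ℝ} (hf : ∀ j, Measurable (f j))
    (hlim : ∀ᵐ x ∂m, Tendsto (fun j => f j x) atTop (𝓝 0))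
    (hdom : ∀ ε : ℝ≥0∞, 0 < ε → ∃ M : ℝ≥0∞, M ≠ ∞ ∧ ∀ᶠ j in atTop, ∃ τ : α → ℝ≥0∞,
      Measurable τ ∧ (∀ᵐ x ∂m, ‖f j x‖ₑ ≤ M + τ x) ∧ ∫⁻ x, τ x ∂m ≤ ε) :
    Tendsto (fun j => ∫⁻ x, ‖f j x‖ₑ ∂m) atTop (𝓝 0) := by
  rw [ENNReal.tendsto_nhds_zero]
  intro ε hε
  obtain ⟨M, hM, hev⟩ := hdom (ε / 2) (ENNReal.half_pos hε.ne')
  have hmin : Tendsto (fun j => ∫⁻ x, min ‖f j x‖ₑ M ∂m) atTop (𝓝 0) := by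
    have h := tendsto_lintegral_of_dominated_convergence (μ := m)
      (F := fun j x => min ‖f j x‖ₑ M) (f := fun _ => 0) (fun _ => M)
      (fun j => (hf j).enorm.min measurable_const)
      (fun j => ae_of_all _ fun x => min_le_right _ _)
      (by rw [lintegral_const]; exact ENNReal.mul_ne_top hM (measure_ne_top _ _)) ?_
    · simpa using h
    · filter_upwards [hlim] with x hx
      have h1 : Tendsto (fun j => ‖f j x‖ₑ) atTop (𝓝 0) := by simpa using hx.enorm
      simpa using h1.min (tendsto_const_nhds (x := M))
  filter_upwards [hev, ENNReal.tendsto_nhds_zero.1 hmin (ε / 2) (ENNReal.half_pos hε.ne')]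
    with j ⟨τ, hτ, hle, hint⟩ hj
  calc ∫⁻ x, ‖f j x‖ₑ ∂m ≤ ∫⁻ x, (min ‖f j x‖ₑ M + τ x) ∂m := by
        refine lintegral_mono_ae ?_
        filter_upwards [hle] with x hx
        rcases le_total ‖f j x‖ₑ M with h | h
        · rw [min_eq_left h]
          exact le_self_add
        · rwa [min_eq_right h]
    _ = ∫⁻ x, min ‖f j x‖ₑ M ∂m + ∫⁻ x, τ x ∂m := lintegral_add_right _ hτ
    _ ≤ ε / 2 + ε / 2 := add_le_add hj hint
    _ = ε := ENNReal.add_halves ε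

/-- If two sequences of finite multisets have bounded logarithmic means, almost everywhere
convergence to zero of the difference of their normalised potentials improves to local convergence
in mean. -/
theorem tendsto_lintegral_enorm_logPotential_sub {s t : ℕ → Multiset ℂ} {N : ℕ → ℝ} {C : ℝ}
    (hN : ∀ᶠ j in atTop, 0 < N j)
    (hs : ∀ᶠ j in atTop, ((s j).card : ℝ) ≤ N j) (ht : ∀ᶠ j in atTop, ((t j).card : ℝ) ≤ N j)
    (hsC : ∀ᶠ j in atTop, ((s j).map fun w => Real.posLog ‖w‖).sum ≤ C * N j)
    (htC : ∀ᶠ j in atTop, ((t j).map fun w => Real.posLog ‖w‖).sum ≤ C * N j)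
    (hlim : ∀ᵐ z : ℂ, Tendsto (fun j => (N j)⁻¹ * (logPotential (s j) z - logPotential (t j) z))
      atTop (𝓝 0)) (R : ℝ) :
    Tendsto (fun j => ∫⁻ z in Metric.ball (0 : ℂ) R,
      ‖(N j)⁻¹ * (logPotential (s j) z - logPotential (t j) z)‖ₑ) atTop (𝓝 0) := by
  have : IsFiniteMeasure (volume.restrict (Metric.ball (0 : ℂ) R)) :=
    ⟨by rw [Measure.restrict_apply_univ]; exact Metric.isBounded_ball.measure_lt_top⟩
  refine tendsto_lintegral_enorm_of_le_add (fun j => ?_) (ae_restrict_of_ae hlim) ?_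
  · exact ((measurable_logPotential _).sub (measurable_logPotential _)).const_mul _
  intro η hη
  set I : ℝ≥0∞ := ∫⁻ z in Metric.ball (0 : ℂ) 1, ENNReal.ofReal ‖z‖⁻¹ with hI
  have hItop : I ≠ ∞ := lintegral_ball_inv_norm_lt_top.ne
  -- the truncation scale `ε` is chosen so that both singular parts together have mean at most `η`
  obtain ⟨ε, hε, hε1, hεη⟩ : ∃ ε : ℝ, 0 < ε ∧ ε ≤ 1 ∧ 2 * (ENNReal.ofReal ε * I) ≤ η := by
    have h1 : Tendsto (fun ε : ℝ => 2 * (ENNReal.ofReal ε * I)) (𝓝[>] 0) (𝓝 0) := by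
      have h2 : Tendsto (fun ε : ℝ => ENNReal.ofReal ε) (𝓝[>] 0) (𝓝 0) := by
        have := (ENNReal.continuous_ofReal.tendsto 0).mono_left
          (nhdsWithin_le_nhds (s := Set.Ioi 0))
        simpa using this
      have h3 := ENNReal.Tendsto.mul_const h2 (Or.inr hItop)
      have h4 := ENNReal.Tendsto.const_mul (a := 2) h3 (Or.inr (by simp))
      simpa using h4
    have h5 := (ENNReal.tendsto_nhds_zero.1 h1 η hη).and
      ((Ioc_mem_nhdsGT (zero_lt_one' ℝ)))
    obtain ⟨ε, h6, h7⟩ := h5.exists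
    exact ⟨ε, h7.1, h7.2, h6⟩
  set A : ℝ := Real.posLog R + Real.log 2 + Real.posLog ε⁻¹ with hA
  have hA0 : 0 ≤ A := by
    have := @Real.posLog_nonneg R
    have := @Real.posLog_nonneg ε⁻¹
    have := Real.log_nonneg (one_le_two (α := ℝ))
    positivity
  refine ⟨ENNReal.ofReal (2 * (A + C)), ENNReal.ofReal_ne_top, ?_⟩
  filter_upwards [hN, hs, ht, hsC, htC] with j hNj hsj htj hsCj htCj
  refine ⟨fun z => ENNReal.ofReal ((N j)⁻¹ * ((s j + t j).map
    fun w => Real.posLog (ε / ‖z - w‖)).sum),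
    ((measurable_sum_posLog_div ε _).const_mul _).ennreal_ofReal, ?_, ?_⟩
  · filter_upwards [ae_restrict_mem Metric.isOpen_ball.measurableSet] with z hz
    have hzR : ‖z‖ ≤ R := (mem_ball_zero_iff.1 hz).le
    rw [← ofReal_norm, Real.norm_eq_abs]
    refine le_trans (ENNReal.ofReal_le_ofReal ?_) ENNReal.ofReal_add_le
    rw [abs_mul, abs_of_pos (inv_pos.2 hNj)]
    have h1 := abs_logPotential_le hε hzR (s j)
    have h2 := abs_logPotential_le hε hzR (t j)
    have h3 := abs_sub (logPotential (s j) z) (logPotential (t j) z)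
    have h4 : ((s j).card : ℝ) * A ≤ N j * A := mul_le_mul_of_nonneg_right hsj hA0
    have h5 : ((t j).card : ℝ) * A ≤ N j * A := mul_le_mul_of_nonneg_right htj hA0
    rw [Multiset.map_add, Multiset.sum_add]
    have h6 : |logPotential (s j) z - logPotential (t j) z| ≤ N j * (2 * (A + C)) +
        (((s j).map fun w => Real.posLog (ε / ‖z - w‖)).sum
          + ((t j).map fun w => Real.posLog (ε / ‖z - w‖)).sum) := by
      linarith
    calc (N j)⁻¹ * |logPotential (s j) z - logPotential (t j) z|
        ≤ (N j)⁻¹ * (N j * (2 * (A + C)) +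
        (((s j).map fun w => Real.posLog (ε / ‖z - w‖)).sum
          + ((t j).map fun w => Real.posLog (ε / ‖z - w‖)).sum)) :=
          mul_le_mul_of_nonneg_left h6 (inv_pos.2 hNj).le
      _ = _ := by rw [mul_add, inv_mul_cancel_left₀ hNj.ne']
  · refine le_trans (setLIntegral_le_lintegral _ _) (le_trans ?_ hεη)
    simp only [ENNReal.ofReal_mul (inv_pos.2 hNj).le]
    rw [lintegral_const_mul _ (measurable_sum_posLog_div ε _).ennreal_ofReal]
    calc ENNReal.ofReal (N j)⁻¹ * ∫⁻ z : ℂ, ENNReal.ofReal ((s j + t j).map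
          fun w => Real.posLog (ε / ‖z - w‖)).sum
        ≤ ENNReal.ofReal (N j)⁻¹ * ((s j + t j).card * (ENNReal.ofReal ε * I)) := by
          gcongr
          exact lintegral_sum_posLog_div_le hε hε1 _
      _ ≤ ENNReal.ofReal (N j)⁻¹ * (ENNReal.ofReal (2 * N j) * (ENNReal.ofReal ε * I)) := by
          gcongr
          rw [← ENNReal.ofReal_natCast]
          refine ENNReal.ofReal_le_ofReal ?_
          rw [Multiset.card_add]
          push_cast
          linarith
      _ = 2 * (ENNReal.ofReal ε * I) := by
          rw [← mul_assoc, ← ENNReal.ofReal_mul (inv_pos.2 hNj).le,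
            show (N j)⁻¹ * (2 * N j) = 2 by field_simp]
          simp

/-- Almost everywhere closeness of the normalised potentials of two sequences of finite multisets
with bounded logarithmic means implies closeness of the bump averages. -/
theorem tendsto_sum_bump_sub {s t : ℕ → Multiset ℂ} {N : ℕ → ℝ} {C : ℝ}
    (hN : ∀ᶠ j in atTop, 0 < N j)
    (hs : ∀ᶠ j in atTop, ((s j).card : ℝ) ≤ N j) (ht : ∀ᶠ j in atTop, ((t j).card : ℝ) ≤ N j)
    (hsC : ∀ᶠ j in atTop, ((s j).map fun w => Real.posLog ‖w‖).sum ≤ C * N j)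
    (htC : ∀ᶠ j in atTop, ((t j).map fun w => Real.posLog ‖w‖).sum ≤ C * N j)
    (hlim : ∀ᵐ z : ℂ, Tendsto (fun j => (N j)⁻¹ * (logPotential (s j) z - logPotential (t j) z))
      atTop (𝓝 0)) {δ : ℝ} (hδ : 0 < δ) (c : ℂ) :
    Tendsto (fun j => (N j)⁻¹ * (((s j).map fun w => bump δ (w - c)).sum
      - ((t j).map fun w => bump δ (w - c)).sum)) atTop (𝓝 0) := by
  have hL1 := tendsto_lintegral_enorm_logPotential_sub hN hs ht hsC htC hlim (4 * δ + ‖c‖)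
  set f : ℕ → ℂ → ℝ := fun j z => (N j)⁻¹ * (logPotential (s j) z - logPotential (t j) z)
  have hrepr : ∀ j, (N j)⁻¹ * (((s j).map fun w => bump δ (w - c)).sum
      - ((t j).map fun w => bump δ (w - c)).sum) = ∫ z, bumpProfile δ ‖z - c‖ * f j z := by
    intro j
    rw [← integral_bumpProfile_mul_logPotential hδ, ← integral_bumpProfile_mul_logPotential hδ,
      ← integral_sub (integrable_bumpProfile_mul_logPotential hδ c _)
        (integrable_bumpProfile_mul_logPotential hδ c _), ← integral_const_mul]
    refine integral_congr_ae (ae_of_all _ fun z => ?_)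
    simp only [f]
    ring
  simp only [hrepr]
  rw [tendsto_zero_iff_enorm_tendsto_zero]
  have hbound : Tendsto (fun j => ENNReal.ofReal (2 * δ⁻¹) *
      ∫⁻ z in Metric.ball (0 : ℂ) (4 * δ + ‖c‖), ‖f j z‖ₑ) atTop (𝓝 0) := by
    have h := ENNReal.Tendsto.const_mul (a := ENNReal.ofReal (2 * δ⁻¹)) hL1
      (Or.inr ENNReal.ofReal_ne_top)
    rwa [mul_zero] at h
  refine tendsto_of_tendsto_of_tendsto_of_le_of_le tendsto_const_nhds hbound
    (fun _ => zero_le) fun j => ?_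
  refine (enorm_integral_le_lintegral_enorm _).trans ?_
  have hfm : Measurable fun z => ‖f j z‖ₑ :=
    (((measurable_logPotential _).sub (measurable_logPotential _)).const_mul _).enorm
  rw [← lintegral_const_mul _ hfm, ← lintegral_indicator Metric.isOpen_ball.measurableSet]
  refine lintegral_mono fun z => ?_
  by_cases hz : ‖z‖ < 4 * δ + ‖c‖
  · rw [Set.indicator_of_mem (by simpa using hz), enorm_mul]
    gcongr
    rw [← ofReal_norm, Real.norm_eq_abs]
    exact ENNReal.ofReal_le_ofReal (abs_bumpProfile_le hδ _)
  · have : 3 * δ < ‖z - c‖ := by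
      have := norm_sub_norm_le z c
      linarith
    simp [bumpProfile_eq_zero hδ this]

/-! ### Integrals against empirical measures -/

theorem integrable_sum_dirac (f : ℂ → ℝ) (s : Multiset ℂ) :
    Integrable f (s.map Measure.dirac).sum := by
  induction s using Multiset.induction_on with
  | empty => simp
  | cons w s ih =>
    rw [Multiset.map_cons, Multiset.sum_cons]
    exact (integrable_dirac (by simp)).add_measure ih

theorem integral_sum_dirac (f : ℂ → ℝ) (s : Multiset ℂ) :
    ∫ w, f w ∂(s.map Measure.dirac).sum = (s.map f).sum := by
  induction s using Multiset.induction_on with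
  | empty => simp
  | cons w s ih =>
    rw [Multiset.map_cons, Multiset.sum_cons, Multiset.map_cons, Multiset.sum_cons,
      integral_add_measure (integrable_dirac (by simp)) (integrable_sum_dirac f s),
      integral_dirac, ih]

theorem integral_empiricalMeasure (f : ℂ → ℝ) {s : Multiset ℂ} (hs : s ≠ 0) :
    ∫ w, f w ∂(empiricalMeasure s : Measure ℂ) = (s.card : ℝ)⁻¹ * (s.map f).sum := by
  have h : empiricalMeasure s = ⟨countingAverage s, isProbabilityMeasure_countingAverage hs⟩ :=
    dif_neg hs
  rw [h, ProbabilityMeasure.coe_mk, countingAverage, integral_smul_measure, integral_sum_dirac f]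
  simp

theorem integral_empiricalMeasure_range (f : ℂ → ℝ) (z : ℕ → ℂ) {n : ℕ}
    (hn : n ≠ 0) :
    ∫ w, f w ∂(empiricalMeasure ((Multiset.range n).map z) : Measure ℂ)
      = (n : ℝ)⁻¹ * ∑ k ∈ Finset.range n, f (z k) := by
  rw [integral_empiricalMeasure f fun h => hn (by simpa using congrArg Multiset.card h),
    Multiset.map_map, Multiset.card_map, Multiset.card_range]
  rfl

/-! ### Critical points of polynomials with given zeros -/

theorem polyOfZeros_ne_zero (z : ℕ → ℂ) (n : ℕ) : polyOfZeros z n ≠ 0 :=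
  (monic_prod_of_monic _ _ fun _ _ => monic_X_sub_C _).ne_zero

theorem monic_polyOfZeros (z : ℕ → ℂ) (n : ℕ) : (polyOfZeros z n).Monic :=
  monic_prod_of_monic _ _ fun _ _ => monic_X_sub_C _

theorem roots_polyOfZeros (z : ℕ → ℂ) (n : ℕ) :
    (polyOfZeros z n).roots = (Multiset.range n).map z := by
  have h : polyOfZeros z n = (((Multiset.range n).map z).map fun a => X - C a).prod := by
    rw [Multiset.map_map]
    rfl
  rw [h, roots_multiset_prod_X_sub_C]

theorem zeroMeasure_polyOfZeros (z : ℕ → ℂ) (n : ℕ) :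
    zeroMeasure (polyOfZeros z n) = empiricalMeasure ((Multiset.range n).map z) := by
  rw [zeroMeasure, roots_polyOfZeros]

theorem natDegree_polyOfZeros (z : ℕ → ℂ) (n : ℕ) : (polyOfZeros z n).natDegree = n := by
  rw [← (IsAlgClosed.splits (polyOfZeros z n)).natDegree_eq_card_roots.symm, roots_polyOfZeros]
  simp

theorem card_roots_derivative_polyOfZeros (z : ℕ → ℂ) (n : ℕ) :
    (derivative (polyOfZeros z n)).roots.card = n - 1 := by
  rw [← (IsAlgClosed.splits _).natDegree_eq_card_roots, natDegree_derivative,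
    natDegree_polyOfZeros]

theorem leadingCoeff_derivative_polyOfZeros (z : ℕ → ℂ) {n : ℕ} (hn : n ≠ 0) :
    (derivative (polyOfZeros z n)).leadingCoeff = n := by
  have hc : (polyOfZeros z n).coeff n = 1 := by
    have := monic_polyOfZeros z n
    rwa [Monic, leadingCoeff, natDegree_polyOfZeros] at this
  have hn1 : n - 1 + 1 = n := Nat.succ_pred_eq_of_ne_zero hn
  rw [leadingCoeff, natDegree_derivative, natDegree_polyOfZeros, coeff_derivative, hn1, hc, one_mul]
  exact_mod_cast congrArg (Nat.cast : ℕ → ℂ) hn1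

theorem norm_eval_derivative_polyOfZeros_le (z : ℕ → ℂ) (n : ℕ) {x : ℂ} (hx : ‖x‖ ≤ 1) :
    ‖(derivative (polyOfZeros z n)).eval x‖ ≤ n * ∏ k ∈ Finset.range n, (1 + ‖z k‖) := by
  rw [polyOfZeros, derivative_prod_finset, eval_finsetSum]
  refine (norm_sum_le _ _).trans ?_
  have h : ∀ i ∈ Finset.range n,
      ‖eval x ((∏ j ∈ (Finset.range n).erase i, (X - C (z j))) * derivative (X - C (z i)))‖
        ≤ ∏ k ∈ Finset.range n, (1 + ‖z k‖) := by
    intro i hi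
    rw [derivative_X_sub_C, mul_one, eval_prod, norm_prod, ← Finset.mul_prod_erase _ _ hi]
    refine le_trans ?_ (le_mul_of_one_le_left (Finset.prod_nonneg fun k _ => by positivity)
      (le_add_of_nonneg_right (norm_nonneg _)))
    refine Finset.prod_le_prod (fun _ _ => norm_nonneg _) fun k _ => ?_
    rw [eval_sub, eval_X, eval_C]
    exact (norm_sub_le _ _).trans (by gcongr)
  refine (Finset.sum_le_sum h).trans (le_of_eq ?_)
  simp

/-- A weak form of Mahler's inequality: differentiating a monic polynomial of degree `n` increases
the sum of `log⁺` of the moduli of the zeros by at most `n log 2`. -/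
theorem sum_posLog_roots_derivative_le (z : ℕ → ℂ) {n : ℕ} (hn : n ≠ 0) :
    ((derivative (polyOfZeros z n)).roots.map fun w => Real.posLog ‖w‖).sum
      ≤ n * Real.log 2 + ∑ k ∈ Finset.range n, Real.posLog ‖z k‖ := by
  set p := derivative (polyOfZeros z n)
  set B : ℝ := n * ∏ k ∈ Finset.range n, (1 + ‖z k‖) with hB
  have hn1 : (1 : ℝ) ≤ n := by exact_mod_cast Nat.one_le_iff_ne_zero.2 hn
  have hprod : 1 ≤ ∏ k ∈ Finset.range n, (1 + ‖z k‖) :=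
    Finset.one_le_prod fun k _ => le_add_of_nonneg_right (norm_nonneg _)
  have hB1 : 1 ≤ B := by nlinarith
  have hmahler := logMahlerMeasure_eq_log_leadingCoeff_add_sum_log_roots p
  rw [leadingCoeff_derivative_polyOfZeros z hn, logMahlerMeasure_def] at hmahler
  have hcirc : Real.circleAverage (fun x => Real.log ‖p.eval x‖) 0 1 ≤ Real.log B := by
    refine Real.circleAverage_mono_on_of_le_circle ?_ fun x hx => ?_
    · exact p.intervalIntegrable_mahlerMeasure
    · have hx1 : ‖x‖ ≤ 1 := by
        rw [abs_one, mem_sphere_zero_iff_norm] at hx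
        exact hx.le
      -- at a zero of `p` on the circle the integrand has the junk value `log 0 = 0`
      by_cases h0 : ‖p.eval x‖ = 0
      · rw [h0, Real.log_zero]
        exact Real.log_nonneg hB1
      · exact Real.log_le_log (lt_of_le_of_ne (norm_nonneg _) (Ne.symm h0))
          (norm_eval_derivative_polyOfZeros_le z n hx1)
  have hlogB : Real.log B ≤ Real.log n
      + (n * Real.log 2 + ∑ k ∈ Finset.range n, Real.posLog ‖z k‖) := by
    rw [hB, Real.log_mul (by positivity) (by positivity), Real.log_prod fun k _ => by positivity]
    gcongr
    have hk : ∀ k ∈ Finset.range n, Real.log (1 + ‖z k‖) ≤ Real.log 2 + Real.posLog ‖z k‖ := by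
      intro k _
      have h1 := @Real.posLog_add 1 ‖z k‖
      rw [Real.posLog_one, add_zero] at h1
      exact (le_max_right _ _).trans h1
    refine (Finset.sum_le_sum hk).trans (le_of_eq ?_)
    rw [Finset.sum_add_distrib, Finset.sum_const, Finset.card_range, nsmul_eq_mul]
  rw [Complex.norm_natCast] at hmahler
  linarith

/-- Away from the zeros and the critical points, the difference of their potentials is the logarithm
of the modulus of the logarithmic derivative, up to the logarithm of the leading coefficient `n` of
the derivative. -/
theorem logPotential_derivative_sub (z : ℕ → ℂ) {n : ℕ} (hn : n ≠ 0) {x : ℂ}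
    (hx : (polyOfZeros z n).eval x ≠ 0) (hx' : (derivative (polyOfZeros z n)).eval x ≠ 0) :
    logPotential (derivative (polyOfZeros z n)).roots x - logPotential (polyOfZeros z n).roots x
      = Real.log ‖∑ k ∈ Finset.range n, (x - z k)⁻¹‖ - Real.log n := by
  have h1 := log_norm_eval_eq hx
  have h2 := log_norm_eval_eq hx'
  have h3 := (IsAlgClosed.splits (polyOfZeros z n)).eval_derivative_eq_eval_mul_sum hx
  have hsum : ((polyOfZeros z n).roots.map fun w => 1 / (x - w)).sum
      = ∑ k ∈ Finset.range n, (x - z k)⁻¹ := by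
    rw [roots_polyOfZeros, Multiset.map_map]
    simp [Finset.sum]
  rw [hsum] at h3
  rw [(monic_polyOfZeros z n).leadingCoeff, norm_one, Real.log_one, zero_add] at h1
  rw [leadingCoeff_derivative_polyOfZeros z hn, Complex.norm_natCast, h3, norm_mul,
    Real.log_mul (by simpa using hx), h1] at h2
  · linarith
  · intro h0
    rw [norm_eq_zero] at h0
    rw [h0, mul_zero] at h3
    exact hx' h3

/-- The deterministic criterion: along a sequence of degrees for which the logarithmic derivative
is subexponential, from above and below, at almost every point, the critical points are distributed
like the zeros. -/
theorem tendsto_zeroMeasure_derivative {μ : ProbabilityMeasure ℂ} {z : ℕ → ℂ}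
    (hz : IsDistributed μ z) (hlog : LogCesaroBounded z) {n : ℕ → ℕ} (hn : Tendsto n atTop atTop)
    (hlim : ∀ᵐ x : ℂ, Tendsto
      (fun j => (n j : ℝ)⁻¹ * Real.log ‖∑ k ∈ Finset.range (n j), (x - z k)⁻¹‖) atTop (𝓝 0)) :
    Tendsto (fun j => zeroMeasure (derivative (polyOfZeros z (n j)))) atTop (𝓝 μ) := by
  obtain ⟨C, hC⟩ := hlog
  have hn2 : ∀ᶠ j in atTop, 2 ≤ n j := hn.eventually_ge_atTop 2
  have hnR : Tendsto (fun j => (n j : ℝ)) atTop atTop := tendsto_natCast_atTop_atTop.comp hn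
  have hsum : ∀ m : ℕ, ∑ k ∈ Finset.range m, Real.posLog ‖z k‖ ≤ C * m := by
    intro m
    rcases Nat.eq_zero_or_pos m with rfl | hm
    · simp
    · have h1 := (abs_le.1 (hC m)).2
      have hm' : (0 : ℝ) < m := by exact_mod_cast hm
      rwa [one_div, inv_mul_le_iff₀ hm', mul_comm] at h1
  have hlog2 : 0 ≤ Real.log 2 := Real.log_nonneg one_le_two
  have hpot : ∀ᵐ x : ℂ, Tendsto (fun j => (n j : ℝ)⁻¹ *
      (logPotential (derivative (polyOfZeros z (n j))).roots x
        - logPotential (polyOfZeros z (n j)).roots x)) atTop (𝓝 0) := by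
    have hcount : {x : ℂ | ∃ m : ℕ, m ≠ 0 ∧ ((polyOfZeros z m).eval x = 0 ∨
        (derivative (polyOfZeros z m)).eval x = 0)}.Countable := by
      have hsub : {x : ℂ | ∃ m : ℕ, m ≠ 0 ∧ ((polyOfZeros z m).eval x = 0 ∨
          (derivative (polyOfZeros z m)).eval x = 0)} ⊆
          ⋃ m : ℕ, ((polyOfZeros z m).rootSet ℂ ∪ (derivative (polyOfZeros z m)).rootSet ℂ) := by
        rintro x ⟨m, hm, h | h⟩
        · refine Set.mem_iUnion.2 ⟨m, Or.inl ?_⟩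
          rw [mem_rootSet]
          exact ⟨polyOfZeros_ne_zero z m, by simpa using h⟩
        · refine Set.mem_iUnion.2 ⟨m, Or.inr ?_⟩
          rw [mem_rootSet]
          refine ⟨fun h0 => ?_, by simpa using h⟩
          have := leadingCoeff_derivative_polyOfZeros z hm
          rw [h0, leadingCoeff_zero] at this
          exact hm (by exact_mod_cast this.symm)
      exact (Set.countable_iUnion fun m =>
        ((rootSet_finite _ _).union (rootSet_finite _ _)).countable).mono hsub
    filter_upwards [hlim, compl_mem_ae_iff.2 (hcount.measure_zero volume)] with x hx hx0
    have hlogn : Tendsto (fun j => (n j : ℝ)⁻¹ * Real.log (n j)) atTop (𝓝 0) := by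
      have := (Real.isLittleO_log_id_atTop.tendsto_div_nhds_zero).comp hnR
      refine this.congr fun j => ?_
      simp [div_eq_inv_mul]
    have h := hx.sub hlogn
    rw [sub_zero] at h
    refine h.congr' ?_
    filter_upwards [hn2] with j hj
    have hj0 : n j ≠ 0 := by omega
    rw [logPotential_derivative_sub z hj0, mul_sub]
    · exact fun h0 => hx0 ⟨n j, hj0, Or.inl h0⟩
    · exact fun h0 => hx0 ⟨n j, hj0, Or.inr h0⟩
  refine tendsto_of_tendsto_integral_bump fun m => ae_of_all _ fun c => ?_
  have hδ : (0 : ℝ) < 1 / ((m : ℝ) + 1) := by positivity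
  set δ : ℝ := 1 / ((m : ℝ) + 1)
  have hcont : Continuous fun w : ℂ => bump δ (w - c) :=
    (continuous_bump hδ).comp (continuous_id.sub continuous_const)
  have hdiff := tendsto_sum_bump_sub (s := fun j => (derivative (polyOfZeros z (n j))).roots)
    (t := fun j => (polyOfZeros z (n j)).roots) (N := fun j => (n j : ℝ)) (C := C + Real.log 2)
    (by filter_upwards [hn2] with j hj; exact_mod_cast (by omega : 0 < n j))
    (Eventually.of_forall fun j => by
      rw [card_roots_derivative_polyOfZeros]
      exact_mod_cast Nat.sub_le _ _)
    (Eventually.of_forall fun j => by simp [roots_polyOfZeros])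
    (by
      filter_upwards [hn2] with j hj
      have h1 := sum_posLog_roots_derivative_le z (n := n j) (by omega)
      have h2 := hsum (n j)
      linarith)
    (Eventually.of_forall fun j => by
      have h2 := hsum (n j)
      have h3 : 0 ≤ (n j : ℝ) * Real.log 2 := by positivity
      rw [roots_polyOfZeros, Multiset.map_map]
      refine le_trans (le_of_eq ?_) (by linarith : ∑ k ∈ Finset.range (n j), Real.posLog ‖z k‖ ≤ _)
      rfl)
    hpot hδ c
  have hzero : Tendsto (fun j => (n j : ℝ)⁻¹ *
      ((polyOfZeros z (n j)).roots.map fun w => bump δ (w - c)).sum) atTop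
      (𝓝 (∫ w, bump δ (w - c) ∂(μ : Measure ℂ))) := by
    obtain ⟨K, hK⟩ := exists_forall_bump_le hδ
    have h1 := (ProbabilityMeasure.tendsto_iff_forall_integral_tendsto.1 (hz.comp hn))
      (BoundedContinuousFunction.ofNormedAddCommGroup (fun w : ℂ => bump δ (w - c)) hcont K
        fun w => by rw [Real.norm_of_nonneg (bump_nonneg hδ _)]; exact hK _)
    refine h1.congr' ?_
    filter_upwards [hn2] with j hj
    simp only [Function.comp_apply, BoundedContinuousFunction.coe_ofNormedAddCommGroup]
    rw [integral_empiricalMeasure_range _ z (by omega), roots_polyOfZeros, Multiset.map_map]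
    rfl
  have hcrit := hdiff.add hzero
  rw [zero_add] at hcrit
  -- there are only `n - 1` critical points, whereas the potentials are normalised by `n`
  have hratio : Tendsto (fun j => (n j : ℝ) / ((n j : ℝ) - 1)) atTop (𝓝 1) := by
    have h1 : Tendsto (fun j => ((n j : ℝ) - 1)⁻¹) atTop (𝓝 0) :=
      tendsto_inv_atTop_zero.comp (tendsto_atTop_add_const_right _ (-1) hnR)
    have h2 := h1.const_add 1
    rw [add_zero] at h2
    refine h2.congr' ?_
    filter_upwards [hn2] with j hj
    have : (2 : ℝ) ≤ n j := by exact_mod_cast hj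
    have : (n j : ℝ) - 1 ≠ 0 := by linarith
    field_simp
    ring
  have hfinal := hratio.mul hcrit
  rw [one_mul] at hfinal
  refine hfinal.congr' ?_
  filter_upwards [hn2] with j hj
  have hcard := card_roots_derivative_polyOfZeros z (n j)
  have h2 : (2 : ℝ) ≤ n j := by exact_mod_cast hj
  have h3 : (n j : ℝ) - 1 ≠ 0 := by linarith
  rw [zeroMeasure, integral_empiricalMeasure _, hcard, Nat.cast_sub (by omega), Nat.cast_one]
  · field_simp
    ring
  · intro h0
    rw [h0, Multiset.card_zero] at hcard
    omega

/-! ### The law of large numbers for the zeros -/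

/-- A strong law of large numbers for independent, uniformly bounded, centred random variables that
need not be identically distributed, from Hoeffding's inequality and the Borel-Cantelli lemma. -/
theorem ae_tendsto_average_zero {Ω : Type*} [MeasurableSpace Ω] {P : Measure Ω}
    [IsProbabilityMeasure P] {Y : ℕ → Ω → ℝ} (hm : ∀ k, Measurable (Y k)) (hY : iIndepFun Y P)
    {M : ℝ} (hM : 0 < M) (hb : ∀ k, ∀ᵐ ω ∂P, |Y k ω| ≤ M) (h0 : ∀ k, ∫ ω, Y k ω ∂P = 0) :
    ∀ᵐ ω ∂P, Tendsto (fun n : ℕ => (n : ℝ)⁻¹ * ∑ k ∈ Finset.range n, Y k ω) atTop (𝓝 0) := by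
  have hsub : ∀ k, HasSubgaussianMGF (Y k) ((‖M - (-M)‖₊ / 2) ^ 2) P := fun k =>
    hasSubgaussianMGF_of_mem_Icc_of_integral_eq_zero (hm k).aemeasurable
      (by filter_upwards [hb k] with ω hω using abs_le.1 hω) (h0 k)
  have hc : (((‖M - (-M)‖₊ / 2) ^ 2 : NNReal) : ℝ) = M ^ 2 := by
    push_cast
    rw [Real.norm_of_nonneg (by linarith)]
    ring
  have key : ∀ ε : ℝ, 0 < ε → ∀ᵐ ω ∂P, ∀ᶠ n : ℕ in atTop,
      |(n : ℝ)⁻¹ * ∑ k ∈ Finset.range n, Y k ω| < ε := by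
    intro ε hε
    set r : ℝ := Real.exp (-ε ^ 2 / (2 * M ^ 2)) with hr
    have hr1 : r < 1 := by
      rw [hr, Real.exp_lt_one_iff, neg_div]
      exact neg_lt_zero.2 (by positivity)
    have hbound : ∀ Z : ℕ → Ω → ℝ, iIndepFun Z P →
        (∀ k, HasSubgaussianMGF (Z k) ((‖M - (-M)‖₊ / 2) ^ 2) P) → ∀ n : ℕ,
        P {ω | n * ε ≤ ∑ k ∈ Finset.range n, Z k ω} ≤ ENNReal.ofReal (r ^ n) := by
      intro Z hZ hsubZ n
      rw [← ofReal_measureReal]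
      refine ENNReal.ofReal_le_ofReal ?_
      refine (HasSubgaussianMGF.measure_sum_range_ge_le_of_iIndepFun hZ (n := n)
        (fun k _ => hsubZ k) (by positivity)).trans (le_of_eq ?_)
      rw [hc, hr, ← Real.exp_nat_mul]
      congr 1
      rcases Nat.eq_zero_or_pos n with rfl | hn
      · simp
      · have hn' : (0 : ℝ) < n := by exact_mod_cast hn
        field_simp
    have hsum : ∑' n : ℕ, ENNReal.ofReal (r ^ n) ≠ ∞ := by
      rw [← ENNReal.ofReal_tsum_of_nonneg (fun n => by positivity)
        (summable_geometric_of_lt_one (Real.exp_pos _).le hr1)]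
      exact ENNReal.ofReal_ne_top
    have hpos := ae_eventually_notMem (μ := P)
      (ne_top_of_le_ne_top hsum (ENNReal.tsum_le_tsum (hbound Y hY hsub)))
    have hneg := ae_eventually_notMem (μ := P)
      (ne_top_of_le_ne_top hsum (ENNReal.tsum_le_tsum (hbound (fun k => -Y k)
        (hY.comp (fun _ x => -x) fun _ => measurable_neg) fun k => (hsub k).neg)))
    filter_upwards [hpos, hneg] with ω h1 h2
    filter_upwards [h1, h2, eventually_gt_atTop 0] with n h1 h2 hn
    have hn' : (0 : ℝ) < n := by exact_mod_cast hn
    simp only [not_le, Pi.neg_apply, Finset.sum_neg_distrib] at h1 h2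
    rw [abs_mul, abs_of_pos (inv_pos.2 hn'), inv_mul_lt_iff₀ hn', abs_lt]
    constructor <;> linarith
  have hall := ae_all_iff.2 fun m : ℕ => key (1 / ((m : ℝ) + 1)) (by positivity)
  filter_upwards [hall] with ω hω
  rw [Metric.tendsto_atTop']
  intro ε hε
  obtain ⟨m, hm⟩ := exists_nat_one_div_lt hε
  obtain ⟨n₀, hn₀⟩ := eventually_atTop.1 (hω m)
  refine ⟨n₀, fun n hn => ?_⟩
  rw [Real.dist_eq, sub_zero]
  exact (hn₀ n hn.le).trans hm

theorem integral_comp_of_map_eq_half {Ω : Type*} [MeasurableSpace Ω] {P : Measure Ω}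
    {X : Ω → ℂ} (hX : Measurable X) {a b : ℂ}
    (hlaw : P.map X = (1 / 2 : ℝ≥0∞) • Measure.dirac a + (1 / 2 : ℝ≥0∞) • Measure.dirac b)
    {f : ℂ → ℝ} (hf : Continuous f) : ∫ ω, f (X ω) ∂P = (f a + f b) / 2 := by
  have hd : ∀ c : ℂ, Integrable f ((1 / 2 : ℝ≥0∞) • Measure.dirac c) := fun c =>
    (integrable_dirac (by simp)).smul_measure (by simp)
  rw [← integral_map hX.aemeasurable hf.aestronglyMeasurable, hlaw,
    integral_add_measure (hd a) (hd b), integral_smul_measure, integral_smul_measure,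
    integral_dirac, integral_dirac]
  simp
  ring

theorem tendsto_average_of_isDistributed {μ : ProbabilityMeasure ℂ} {a : ℕ → ℂ}
    (ha : IsDistributed μ a) {f : ℂ → ℝ} (hf : Continuous f) {K : ℝ} (hK : ∀ w, |f w| ≤ K) :
    Tendsto (fun n : ℕ => (n : ℝ)⁻¹ * ∑ k ∈ Finset.range n, f (a k)) atTop
      (𝓝 (∫ w, f w ∂(μ : Measure ℂ))) := by
  refine ((ProbabilityMeasure.tendsto_iff_forall_integral_tendsto.1 ha)
    (BoundedContinuousFunction.ofNormedAddCommGroup f hf K hK)).congr' ?_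
  filter_upwards [eventually_ne_atTop 0] with n hn
  exact integral_empiricalMeasure_range f a hn

section Bernoulli

variable {μ : ProbabilityMeasure ℂ} {a b : ℕ → ℂ} {Ω : Type*} [MeasurableSpace Ω] {P : Measure Ω}
  [IsProbabilityMeasure P] {ξ : ℕ → Ω → ℂ}

theorem ae_tendsto_average_comp (ha : IsDistributed μ a) (hb : IsDistributed μ b)
    (hm : ∀ k, Measurable (ξ k)) (hind : iIndepFun ξ P)
    (hlaw : ∀ k, P.map (ξ k) =
      (1 / 2 : ℝ≥0∞) • Measure.dirac (a k) + (1 / 2 : ℝ≥0∞) • Measure.dirac (b k))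
    {f : ℂ → ℝ} (hf : Continuous f) {K : ℝ} (hK : ∀ w, |f w| ≤ K) :
    ∀ᵐ ω ∂P, Tendsto (fun n : ℕ => (n : ℝ)⁻¹ * ∑ k ∈ Finset.range n, f (ξ k ω)) atTop
      (𝓝 (∫ w, f w ∂(μ : Measure ℂ))) := by
  have hK0 : 0 ≤ K := (abs_nonneg _).trans (hK 0)
  have hYm : ∀ k, Measurable fun ω => f (ξ k ω) - (f (a k) + f (b k)) / 2 := fun k =>
    (hf.measurable.comp (hm k)).sub_const _
  have h := ae_tendsto_average_zero (P := P)
    (Y := fun k ω => f (ξ k ω) - (f (a k) + f (b k)) / 2) (M := 2 * K + 1) hYm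
    (hind.comp (fun k x => f x - (f (a k) + f (b k)) / 2) fun k => hf.measurable.sub_const _)
    (by linarith) (fun k => ae_of_all _ fun ω => ?_) fun k => ?_
  · filter_upwards [h] with ω hω
    have h1 := (tendsto_average_of_isDistributed ha hf hK).add
      (tendsto_average_of_isDistributed hb hf hK)
    have h2 := hω.add (h1.div_const 2)
    rw [zero_add, add_self_div_two] at h2
    refine h2.congr fun n => ?_
    rw [Finset.sum_sub_distrib, ← Finset.sum_div, Finset.sum_add_distrib]
    ring
  · have h1 := abs_le.1 (hK (ξ k ω))
    have h2 := abs_le.1 (hK (a k))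
    have h3 := abs_le.1 (hK (b k))
    rw [abs_le]
    constructor <;> linarith [h1.1, h1.2, h2.1, h2.2, h3.1, h3.2]
  · rw [integral_sub, integral_comp_of_map_eq_half (hm k) (hlaw k) hf]
    · simp
    · exact Integrable.of_bound (hf.measurable.comp (hm k)).aestronglyMeasurable K
        (ae_of_all _ fun ω => hK _)
    · exact integrable_const _

/-- Almost surely, the random zeros are `μ`-distributed. -/
theorem ae_isDistributed (ha : IsDistributed μ a) (hb : IsDistributed μ b)
    (hm : ∀ k, Measurable (ξ k)) (hind : iIndepFun ξ P)
    (hlaw : ∀ k, P.map (ξ k) =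
      (1 / 2 : ℝ≥0∞) • Measure.dirac (a k) + (1 / 2 : ℝ≥0∞) • Measure.dirac (b k)) :
    ∀ᵐ ω ∂P, IsDistributed μ fun k => ξ k ω := by
  have hall : ∀ m : ℕ, ∀ᵐ ω ∂P, ∀ᵐ c : ℂ,
      Tendsto (fun n : ℕ => (n : ℝ)⁻¹ * ∑ k ∈ Finset.range n,
        bump (1 / ((m : ℝ) + 1)) (ξ k ω - c)) atTop
        (𝓝 (∫ w, bump (1 / ((m : ℝ) + 1)) (w - c) ∂(μ : Measure ℂ))) := by
    intro m
    have hδ : (0 : ℝ) < 1 / ((m : ℝ) + 1) := by positivity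
    set δ : ℝ := 1 / ((m : ℝ) + 1)
    have hmeas : MeasurableSet {p : Ω × ℂ | Tendsto (fun n : ℕ => (n : ℝ)⁻¹ *
        ∑ k ∈ Finset.range n, bump δ (ξ k p.1 - p.2)) atTop
        (𝓝 (∫ w, bump δ (w - p.2) ∂(μ : Measure ℂ)))} := by
      have hF : ∀ n : ℕ, Measurable fun p : Ω × ℂ => (n : ℝ)⁻¹ *
          ∑ k ∈ Finset.range n, bump δ (ξ k p.1 - p.2) := fun n =>
        (Finset.measurable_sum _ fun k _ => (continuous_bump hδ).measurable.comp
          (((hm k).comp measurable_fst).sub measurable_snd)).const_mul _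
      have hG : Measurable fun p : Ω × ℂ => ∫ w, bump δ (w - p.2) ∂(μ : Measure ℂ) := by
        have : StronglyMeasurable fun c : ℂ => ∫ w, bump δ (w - c) ∂(μ : Measure ℂ) :=
          StronglyMeasurable.integral_prod_right (f := fun c w : ℂ => bump δ (w - c))
            ((continuous_bump hδ).comp
              (continuous_snd.sub continuous_fst)).measurable.stronglyMeasurable
        exact this.measurable.comp measurable_snd
      have h0 := measurableSet_tendsto (𝓝 (0 : ℝ)) (l := atTop) fun n => (hF n).sub hG
      refine (congrArg MeasurableSet (Set.ext fun p => ?_)).mp h0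
      exact tendsto_sub_nhds_zero_iff
    refine Measure.ae_ae_of_ae_prod (p := fun p : Ω × ℂ => Tendsto (fun n : ℕ => (n : ℝ)⁻¹ *
      ∑ k ∈ Finset.range n, bump δ (ξ k p.1 - p.2)) atTop
        (𝓝 (∫ w, bump δ (w - p.2) ∂(μ : Measure ℂ)))) ?_
    rw [Measure.ae_prod_iff_ae_ae hmeas, Measure.ae_ae_comm hmeas]
    refine ae_of_all _ fun c => ?_
    obtain ⟨K, hK⟩ := exists_forall_bump_le hδ
    exact ae_tendsto_average_comp ha hb hm hind hlaw (f := fun w => bump δ (w - c))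
      ((continuous_bump hδ).comp (continuous_id.sub continuous_const)) (K := K)
      fun w => by rw [abs_of_nonneg (bump_nonneg hδ _)]; exact hK _
  filter_upwards [ae_all_iff.2 hall] with ω hω
  refine tendsto_of_tendsto_integral_bump fun m => ?_
  filter_upwards [hω m] with c hc
  refine hc.congr' ?_
  filter_upwards [eventually_ne_atTop 0] with n hn
  exact (integral_empiricalMeasure_range (fun w => bump (1 / ((m : ℝ) + 1)) (w - c)) _ hn).symm

end Bernoulli

/-! ### Anti-concentration -/

theorem centralBinom_sq_mul_le (n : ℕ) : n.centralBinom ^ 2 * (2 * n + 1) ≤ (4 ^ n) ^ 2 := by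
  induction n with
  | zero => simp
  | succ n ih =>
    have h := Nat.succ_mul_centralBinom_succ n
    have h2 : (n + 1) ^ 2 * ((n + 1).centralBinom ^ 2 * (2 * (n + 1) + 1))
        ≤ (n + 1) ^ 2 * (4 ^ (n + 1)) ^ 2 := by
      calc (n + 1) ^ 2 * ((n + 1).centralBinom ^ 2 * (2 * (n + 1) + 1))
          = ((n + 1) * (n + 1).centralBinom) ^ 2 * (2 * n + 3) := by ring
        _ = (4 * (2 * n + 1) * (2 * n + 3)) * (n.centralBinom ^ 2 * (2 * n + 1)) := by
            rw [h]; ring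
        _ ≤ (16 * (n + 1) ^ 2) * (4 ^ n) ^ 2 := Nat.mul_le_mul (by nlinarith) ih
        _ = (n + 1) ^ 2 * (4 ^ (n + 1)) ^ 2 := by ring
    exact Nat.le_of_mul_le_mul_left h2 (by positivity)

theorem tendsto_centralBinom_div_four_pow :
    Tendsto (fun n : ℕ => (n.centralBinom : ℝ) / 4 ^ n) atTop (𝓝 0) := by
  have hs : Tendsto (fun n : ℕ => ((n.centralBinom : ℝ) / 4 ^ n) ^ 2) atTop (𝓝 0) := by
    refine squeeze_zero (fun n => by positivity) (fun n => ?_)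
      tendsto_one_div_add_atTop_nhds_zero_nat
    have h := centralBinom_sq_mul_le n
    have h' : (n.centralBinom : ℝ) ^ 2 * (2 * n + 1) ≤ ((4 : ℝ) ^ n) ^ 2 := by exact_mod_cast h
    rw [div_pow, div_le_div_iff₀ (by positivity) (by positivity), one_mul]
    have : (0 : ℝ) ≤ (n.centralBinom : ℝ) ^ 2 * n := by positivity
    linarith
  have h := hs.sqrt
  rw [Real.sqrt_zero] at h
  exact h.congr fun n => Real.sqrt_sq (by positivity)

/-- The Littlewood-Offord bound in the form due to Erdős: if switching any single summand from
`q i` to `p i` raises a sum by at least `2r`, the choices for which the sum lies in an open interval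
of length `2r` form an antichain. -/
theorem card_filter_abs_lt_le {ι : Type*} [Fintype ι] [DecidableEq ι] {p q : ι → ℝ} {r : ℝ}
    (hr : 0 < r) (hpq : ∀ i, q i + 2 * r ≤ p i) (y : ℝ) :
    (Finset.univ.filter fun A : Finset ι => |y + ∑ i, if i ∈ A then p i else q i| < r).card
      ≤ (Fintype.card ι).choose (Fintype.card ι / 2) := by
  refine IsAntichain.sperner ?_
  intro A hA B hB hne hAB
  simp only [Finset.coe_filter, Finset.mem_univ, true_and, Set.mem_ofPred_eq] at hA hB
  obtain ⟨i, hiB, hiA⟩ := Finset.exists_of_ssubset (hAB.ssubset_of_ne hne)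
  have hterm : ∀ j ∈ Finset.univ,
      0 ≤ (if j ∈ B then p j else q j) - (if j ∈ A then p j else q j) := by
    intro j _
    by_cases hjA : j ∈ A
    · simp [hjA, hAB hjA]
    · by_cases hjB : j ∈ B <;> simp [hjA, hjB]
      linarith [hpq j]
  have h1 := Finset.single_le_sum hterm (Finset.mem_univ i)
  rw [Finset.sum_sub_distrib] at h1
  simp only [hiA, hiB, if_true, if_false] at h1
  rw [abs_lt] at hA hB
  linarith [hpq i, hA.1, hB.2]

section Bernoulli

variable {a b : ℕ → ℂ} {Ω : Type*} [MeasurableSpace Ω] {P : Measure Ω} {ξ : ℕ → Ω → ℂ}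

theorem ae_eq_or_eq_of_map_eq_half {X : Ω → ℂ} (hX : Measurable X) {a b : ℂ}
    (hlaw : P.map X = (1 / 2 : ℝ≥0∞) • Measure.dirac a + (1 / 2 : ℝ≥0∞) • Measure.dirac b) :
    ∀ᵐ ω ∂P, X ω = a ∨ X ω = b := by
  have hms : MeasurableSet {w : ℂ | w = a ∨ w = b} :=
    (measurableSet_singleton a).union (measurableSet_singleton b)
  refine (ae_map_iff hX.aemeasurable hms).1 ?_
  rw [hlaw, ae_iff]
  have h : {w : ℂ | ¬(w = a ∨ w = b)} = {w : ℂ | w = a ∨ w = b}ᶜ := rfl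
  rw [h, Measure.add_apply, Measure.smul_apply, Measure.smul_apply,
    Measure.dirac_apply' _ hms.compl, Measure.dirac_apply' _ hms.compl]
  simp

theorem measure_preimage_singleton_of_map_eq_half {X : Ω → ℂ} (hX : Measurable X) {a b c : ℂ}
    (hlaw : P.map X = (1 / 2 : ℝ≥0∞) • Measure.dirac a + (1 / 2 : ℝ≥0∞) • Measure.dirac b)
    (hab : a ≠ b) (hc : c = a ∨ c = b) : P (X ⁻¹' {c}) = 1 / 2 := by
  rw [← Measure.map_apply hX (measurableSet_singleton c), hlaw]
  rcases hc with rfl | rfl <;> simp [hab, hab.symm]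

/-- Anti-concentration for a sum of independent variables `h (ξ k)`, in which the summands with
index in `J` take two values at distance at least `2r`. Conditionally on the other summands, the
Littlewood-Offord bound applies. -/
theorem measure_abs_sum_lt_le [IsProbabilityMeasure P] (hm : ∀ k, Measurable (ξ k))
    (hind : iIndepFun ξ P)
    (hlaw : ∀ k, P.map (ξ k) =
      (1 / 2 : ℝ≥0∞) • Measure.dirac (a k) + (1 / 2 : ℝ≥0∞) • Measure.dirac (b k))
    {h : ℂ → ℝ} (hh : Measurable h) {r : ℝ} (hr : 0 < r) {J : Finset ℕ}
    (hJ : ∀ k ∈ J, 2 * r ≤ |h (a k) - h (b k)|) {n : ℕ} (hJn : J ⊆ Finset.range n) :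
    P {ω | |∑ k ∈ Finset.range n, h (ξ k ω)| < r}
      ≤ (1 / 2) ^ J.card * (J.card.choose (J.card / 2) : ℝ≥0∞) := by
  classical
  have hab : ∀ k ∈ J, a k ≠ b k := by
    intro k hk heq
    have := hJ k hk
    rw [heq, sub_self, abs_zero] at this
    linarith
  -- the two values of `ξ k`, ordered so that `h` is larger at `p k`
  obtain ⟨p, q, hpq, hval⟩ : ∃ p q : J → ℂ, (∀ k : J, h (q k) + 2 * r ≤ h (p k)) ∧
      ∀ k : J, (p k = a k ∧ q k = b k) ∨ (p k = b k ∧ q k = a k) := by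
    refine ⟨fun k => if h (b k) ≤ h (a k) then a k else b k,
      fun k => if h (b k) ≤ h (a k) then b k else a k, fun k => ?_, fun k => ?_⟩
    · have h1 := hJ k k.2
      by_cases hle : h (b k) ≤ h (a k)
      · simp only [hle, if_true]
        rw [abs_of_nonneg (sub_nonneg.2 hle)] at h1
        linarith
      · simp only [hle, if_false]
        rw [abs_of_neg (sub_neg.2 (not_le.1 hle))] at h1
        linarith
    · by_cases hle : h (b k) ≤ h (a k) <;> simp [hle]
  set v : Finset J → J → ℂ := fun A k => if k ∈ A then p k else q k with hv
  set T := Finset.range n \ J with hT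
  set Y : Ω → ℝ := fun ω => ∑ k : T, h (ξ k ω) with hY
  have hYm : Measurable Y := Finset.measurable_sum _ fun k _ => hh.comp (hm k)
  have hindep : IndepFun (fun ω (k : J) => ξ k ω) Y P := by
    have h1 := hind.indepFun_finset J T Finset.disjoint_sdiff hm
    exact h1.comp (φ := id) (ψ := fun y : T → ℂ => ∑ k, h (y k)) measurable_id
      (Finset.measurable_sum _ fun k _ => hh.comp (measurable_pi_apply k))
  have hcover : ∀ᵐ ω ∂P, ∃ A : Finset J, (fun k : J => ξ k ω) = v A := by
    have hall := ae_all_iff.2 fun k => ae_eq_or_eq_of_map_eq_half (hm k) (hlaw k)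
    filter_upwards [hall] with ω hω
    refine ⟨Finset.univ.filter fun k : J => ξ k ω = p k, funext fun k => ?_⟩
    by_cases hk : ξ k ω = p k
    · simp [hv, hk]
    · simp only [hv, Finset.mem_filter, Finset.mem_univ, true_and, hk, if_false]
      rcases hval k with ⟨h1, h2⟩ | ⟨h1, h2⟩ <;> rcases hω k with h3 | h3 <;> simp_all
  have hE : ∀ A, P ((fun ω (k : J) => ξ k ω) ⁻¹' {v A}) = (1 / 2) ^ J.card := by
    intro A
    have hset : (fun ω (k : J) => ξ k ω) ⁻¹' {v A}
        = ⋂ k ∈ J, ξ k ⁻¹' (if hk : k ∈ J then {v A ⟨k, hk⟩} else Set.univ) := by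
      ext ω
      simp only [Set.mem_preimage, Set.mem_singleton_iff, Set.mem_iInter, funext_iff,
        Subtype.forall]
      refine forall₂_congr fun k hk => ?_
      simp [hk]
    rw [hset, hind.measure_inter_preimage_eq_mul J (fun k hk => by
      simp only [hk, dite_true]
      exact measurableSet_singleton _), Finset.prod_congr rfl (g := fun _ => (1 / 2 : ℝ≥0∞)),
      Finset.prod_const]
    intro k hk
    simp only [hk, dite_true]
    refine measure_preimage_singleton_of_map_eq_half (hm k) (hlaw k) (hab k hk) ?_
    simp only [hv]
    rcases hval ⟨k, hk⟩ with ⟨h1, h2⟩ | ⟨h1, h2⟩ <;> split_ifs <;> simp_all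
  set B : Finset J → Set ℝ := fun A =>
    {y : ℝ | |y + ∑ k, if k ∈ A then h (p k) else h (q k)| < r} with hB
  have hBm : ∀ A, MeasurableSet (B A) := fun A =>
    measurableSet_lt (by fun_prop) measurable_const
  calc P {ω | |∑ k ∈ Finset.range n, h (ξ k ω)| < r}
      ≤ P (⋃ A : Finset J, (fun ω (k : J) => ξ k ω) ⁻¹' {v A} ∩ Y ⁻¹' B A) := by
        refine measure_mono_ae ?_
        filter_upwards [hcover] with ω ⟨A, hA⟩ hω
        refine Set.mem_iUnion.2 ⟨A, hA, ?_⟩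
        have hsplit : ∑ k ∈ Finset.range n, h (ξ k ω)
            = Y ω + ∑ k : J, if k ∈ A then h (p k) else h (q k) := by
          have hYω : Y ω = ∑ k ∈ T, h (ξ k ω) := Finset.sum_coe_sort T fun k => h (ξ k ω)
          rw [← Finset.sum_sdiff hJn, hYω,
            ← Finset.sum_coe_sort J fun k => h (ξ k ω)]
          congr 1
          refine Finset.sum_congr rfl fun k _ => ?_
          have := congrFun hA k
          rw [this, hv, apply_ite h]
        have hω' : |∑ k ∈ Finset.range n, h (ξ k ω)| < r := hω
        rwa [hsplit] at hω'
    _ ≤ ∑ A : Finset J, P ((fun ω (k : J) => ξ k ω) ⁻¹' {v A} ∩ Y ⁻¹' B A) :=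
        measure_iUnion_fintype_le _ _
    _ = ∑ A : Finset J, (1 / 2) ^ J.card * ∫⁻ ω, (Y ⁻¹' B A).indicator 1 ω ∂P := by
        refine Finset.sum_congr rfl fun A _ => ?_
        rw [hindep.measure_inter_preimage_eq_mul _ _ (measurableSet_singleton _) (hBm A), hE,
          lintegral_indicator_one (hYm (hBm A))]
    _ = (1 / 2) ^ J.card * ∫⁻ ω, ∑ A : Finset J, (Y ⁻¹' B A).indicator 1 ω ∂P := by
        rw [← Finset.mul_sum, lintegral_finsetSum _ fun A _ =>
          measurable_one.indicator (hYm (hBm A))]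
    _ ≤ (1 / 2) ^ J.card * ∫⁻ _, (J.card.choose (J.card / 2) : ℝ≥0∞) ∂P := by
        gcongr with ω
        have hcard := card_filter_abs_lt_le hr hpq (Y ω)
        rw [Fintype.card_coe] at hcard
        refine le_trans (le_of_eq ?_) (Nat.cast_le.2 hcard)
        rw [Finset.card_filter, Nat.cast_sum]
        refine Finset.sum_congr rfl fun A _ => ?_
        by_cases hA : Y ω ∈ B A
        · rw [Set.indicator_of_mem (by exact hA), if_pos (by exact hA)]
          simp
        · rw [Set.indicator_of_notMem (by exact hA), if_neg (by exact hA)]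
          simp
    _ = (1 / 2) ^ J.card * (J.card.choose (J.card / 2) : ℝ≥0∞) := by
        rw [lintegral_const, measure_univ, mul_one]

theorem eventually_measure_abs_sum_lt_le [IsProbabilityMeasure P] (hm : ∀ k, Measurable (ξ k))
    (hind : iIndepFun ξ P)
    (hlaw : ∀ k, P.map (ξ k) =
      (1 / 2 : ℝ≥0∞) • Measure.dirac (a k) + (1 / 2 : ℝ≥0∞) • Measure.dirac (b k))
    {h : ℂ → ℝ} (hh : Measurable h) (hinf : {k | h (a k) ≠ h (b k)}.Infinite)
    {η : ℝ≥0∞} (hη : 0 < η) :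
    ∃ r : ℝ, 0 < r ∧ ∀ᶠ n : ℕ in atTop, P {ω | |∑ k ∈ Finset.range n, h (ξ k ω)| < r} ≤ η := by
  have hlim : Tendsto (fun m : ℕ => ENNReal.ofReal ((m.centralBinom : ℝ) / 4 ^ m))
      atTop (𝓝 0) := by
    have h0 := (ENNReal.continuous_ofReal.tendsto 0).comp tendsto_centralBinom_div_four_pow
    rwa [ENNReal.ofReal_zero] at h0
  obtain ⟨m, hmη⟩ := ((ENNReal.tendsto_nhds_zero.1 hlim) η hη).exists
  obtain ⟨J, hJsub, hJcard⟩ := hinf.exists_subset_card_eq (2 * m)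
  have hev : ∀ᶠ r : ℝ in 𝓝[>] 0, ∀ k ∈ J, 2 * r ≤ |h (a k) - h (b k)| := by
    rw [Finset.eventually_all]
    intro k hk
    have hpos : 0 < |h (a k) - h (b k)| := abs_pos.2 (sub_ne_zero.2 (hJsub hk))
    filter_upwards [Ioc_mem_nhdsGT (half_pos hpos)] with r hr
    linarith [hr.2]
  obtain ⟨r, hJr, hr⟩ := (hev.and self_mem_nhdsWithin).exists
  refine ⟨r, hr, ?_⟩
  filter_upwards [eventually_ge_atTop (J.sup id + 1)] with n hn
  have hJn : J ⊆ Finset.range n := fun k hk => by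
    have : k ≤ J.sup id := Finset.le_sup (f := id) hk
    exact Finset.mem_range.2 (by omega)
  refine (measure_abs_sum_lt_le hm hind hlaw hh hr hJr hJn).trans (le_trans (le_of_eq ?_) hmη)
  have hq : (1 / 2 : ℝ≥0∞) ^ 2 = (ENNReal.ofReal 4)⁻¹ := by
    rw [one_div, ← ENNReal.inv_pow]
    norm_num
  rw [hJcard, Nat.mul_div_cancel_left _ two_pos, ← Nat.centralBinom_eq_two_mul_choose,
    ENNReal.ofReal_div_of_pos (by positivity), ENNReal.ofReal_natCast, pow_mul, hq, mul_comm,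
    ENNReal.ofReal_pow (by norm_num), ENNReal.div_eq_inv_mul, ENNReal.inv_pow, mul_comm]

end Bernoulli

/-! ### The logarithmic derivative of the random polynomial -/

/-- Almost every point of the plane stays polynomially far from the terms of a given sequence; this
is the Borel-Cantelli lemma for the discs of radius `1/(k+1)` around the terms. -/
theorem ae_exists_forall_norm_sub_inv_le (a : ℕ → ℂ) :
    ∀ᵐ z : ℂ, ∃ C : ℝ, ∀ k : ℕ, ‖z - a k‖⁻¹ ≤ C * ((k : ℝ) + 1) := by
  have hvol : ∀ k : ℕ, volume (Metric.ball (a k) (1 / ((k : ℝ) + 1)))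
      = ENNReal.ofReal (1 / ((k : ℝ) + 1) ^ 2) * NNReal.pi := by
    intro k
    rw [Complex.volume_ball, ← ENNReal.ofReal_pow (by positivity), div_pow, one_pow]
  have hsum : ∑' k : ℕ, volume (Metric.ball (a k) (1 / ((k : ℝ) + 1))) ≠ ∞ := by
    simp only [hvol]
    rw [ENNReal.tsum_mul_right]
    refine ENNReal.mul_ne_top ?_ ENNReal.coe_ne_top
    have hs : Summable fun k : ℕ => 1 / ((k : ℝ) + 1) ^ 2 := by
      have := (summable_nat_add_iff 1).2 (Real.summable_one_div_nat_pow.2 one_lt_two)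
      simpa using this
    rw [← ENNReal.ofReal_tsum_of_nonneg (fun k => by positivity) hs]
    exact ENNReal.ofReal_ne_top
  filter_upwards [ae_eventually_notMem hsum] with z hz
  have hbdd : IsBoundedUnder (· ≤ ·) atTop fun k : ℕ => ‖z - a k‖⁻¹ / ((k : ℝ) + 1) := by
    refine ⟨1, ?_⟩
    rw [eventually_map]
    filter_upwards [hz] with k hk
    rw [Metric.mem_ball, not_lt, dist_eq_norm] at hk
    rw [div_le_one (by positivity)]
    have := inv_anti₀ (by positivity) hk
    rwa [one_div, inv_inv] at this
  obtain ⟨C, hC⟩ := hbdd.bddAbove_range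
  refine ⟨C, fun k => ?_⟩
  have := hC ⟨k, rfl⟩
  rwa [div_le_iff₀ (by positivity)] at this

section Bernoulli

variable {a b : ℕ → ℂ} {Ω : Type*} [MeasurableSpace Ω] {P : Measure Ω} {ξ : ℕ → Ω → ℂ}

/-- The logarithmic derivative of the random polynomial at a given point does not concentrate near
the origin: since `a k ≠ b k` infinitely often, the real parts or the imaginary parts of its
summands fluctuate for infinitely many indices. -/
theorem eventually_measure_norm_sum_inv_lt_le [IsProbabilityMeasure P]
    (hm : ∀ k, Measurable (ξ k)) (hind : iIndepFun ξ P)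
    (hlaw : ∀ k, P.map (ξ k) =
      (1 / 2 : ℝ≥0∞) • Measure.dirac (a k) + (1 / 2 : ℝ≥0∞) • Measure.dirac (b k))
    (hab : {k : ℕ | a k ≠ b k}.Infinite) (z : ℂ) {η : ℝ≥0∞} (hη : 0 < η) :
    ∃ r : ℝ, 0 < r ∧ ∀ᶠ n : ℕ in atTop,
      P {ω | ‖∑ k ∈ Finset.range n, (z - ξ k ω)⁻¹‖ < r} ≤ η := by
  have hsub : {k : ℕ | a k ≠ b k} ⊆ {k | ((z - a k)⁻¹).re ≠ ((z - b k)⁻¹).re} ∪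
      {k | ((z - a k)⁻¹).im ≠ ((z - b k)⁻¹).im} := by
    intro k hk
    by_contra hcon
    rw [Set.mem_union, not_or] at hcon
    refine hk ?_
    have h := inv_injective (Complex.ext (not_not.1 hcon.1) (not_not.1 hcon.2))
    exact sub_right_injective h
  rcases Set.infinite_union.1 (hab.mono hsub) with hinf | hinf
  · obtain ⟨r, hr, hev⟩ := eventually_measure_abs_sum_lt_le hm hind hlaw
      (h := fun w => ((z - w)⁻¹).re) (by fun_prop) hinf hη
    refine ⟨r, hr, hev.mono fun n hn => (measure_mono fun ω hω => ?_).trans hn⟩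
    refine lt_of_le_of_lt ?_ (show ‖∑ k ∈ Finset.range n, (z - ξ k ω)⁻¹‖ < r from hω)
    rw [← Complex.re_sum]
    exact Complex.abs_re_le_norm _
  · obtain ⟨r, hr, hev⟩ := eventually_measure_abs_sum_lt_le hm hind hlaw
      (h := fun w => ((z - w)⁻¹).im) (by fun_prop) hinf hη
    refine ⟨r, hr, hev.mono fun n hn => (measure_mono fun ω hω => ?_).trans hn⟩
    refine lt_of_le_of_lt ?_ (show ‖∑ k ∈ Finset.range n, (z - ξ k ω)⁻¹‖ < r from hω)
    rw [← Complex.im_sum]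
    exact Complex.abs_im_le_norm _

/-- At almost every point, the logarithmic derivative of the random polynomial is subexponential in
probability, from above and from below. -/
theorem ae_tendsto_measure_le_abs_log_norm_sum_inv [IsProbabilityMeasure P]
    (hm : ∀ k, Measurable (ξ k)) (hind : iIndepFun ξ P)
    (hlaw : ∀ k, P.map (ξ k) =
      (1 / 2 : ℝ≥0∞) • Measure.dirac (a k) + (1 / 2 : ℝ≥0∞) • Measure.dirac (b k))
    (hab : {k : ℕ | a k ≠ b k}.Infinite) {ε : ℝ} (hε : 0 < ε) :
    ∀ᵐ z : ℂ, Tendsto (fun n : ℕ => P {ω | ε ≤ |(n : ℝ)⁻¹ *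
      Real.log ‖∑ k ∈ Finset.range n, (z - ξ k ω)⁻¹‖|}) atTop (𝓝 0) := by
  have hval := ae_all_iff.2 fun k => ae_eq_or_eq_of_map_eq_half (hm k) (hlaw k)
  filter_upwards [ae_exists_forall_norm_sub_inv_le a, ae_exists_forall_norm_sub_inv_le b]
    with z ⟨Ca, hCa⟩ ⟨Cb, hCb⟩
  have hCa0 : 0 ≤ Ca := by simpa using (inv_nonneg.2 (norm_nonneg _)).trans (hCa 0)
  have hCb0 : 0 ≤ Cb := by simpa using (inv_nonneg.2 (norm_nonneg _)).trans (hCb 0)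
  have hupper : ∀ᵐ ω ∂P, ∀ n : ℕ,
      ‖∑ k ∈ Finset.range n, (z - ξ k ω)⁻¹‖ ≤ (Ca + Cb) * (n : ℝ) ^ 2 := by
    filter_upwards [hval] with ω hω n
    have hk : ∀ k ∈ Finset.range n, ‖(z - ξ k ω)⁻¹‖ ≤ (Ca + Cb) * n := by
      intro k hk
      have hkn : (k : ℝ) + 1 ≤ n := by exact_mod_cast Finset.mem_range.1 hk
      have hk0 : (0 : ℝ) ≤ (k : ℝ) + 1 := by positivity
      have h1 : (Ca + Cb) * ((k : ℝ) + 1) ≤ (Ca + Cb) * n := by gcongr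
      have h2 := mul_nonneg hCa0 hk0
      have h3 := mul_nonneg hCb0 hk0
      rw [norm_inv]
      rcases hω k with h | h <;> rw [h]
      · linarith [hCa k]
      · linarith [hCb k]
    refine (norm_sum_le_of_le _ hk).trans (le_of_eq ?_)
    rw [Finset.sum_const, Finset.card_range, nsmul_eq_mul]
    ring
  have hexp : ∀ᶠ n : ℕ in atTop, (Ca + Cb) * (n : ℝ) ^ 2 < Real.exp (n * ε) := by
    have h1 := ((isLittleO_pow_exp_pos_mul_atTop 2 hε).const_mul_left (Ca + Cb)).comp_tendsto
      tendsto_natCast_atTop_atTop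
    filter_upwards [h1.def (half_pos (zero_lt_one' ℝ))] with n hn
    simp only [Function.comp_apply] at hn
    rw [Real.norm_of_nonneg (by positivity), Real.norm_of_nonneg (Real.exp_pos _).le] at hn
    rw [mul_comm (n : ℝ) ε]
    linarith [Real.exp_pos (ε * (n : ℝ))]
  rw [ENNReal.tendsto_nhds_zero]
  intro η hη
  obtain ⟨r, hr, hev⟩ := eventually_measure_norm_sum_inv_lt_le hm hind hlaw hab z hη
  have hsmall : ∀ᶠ n : ℕ in atTop, Real.exp (-(n * ε)) < r := by
    have h1 : Tendsto (fun n : ℕ => Real.exp (-(n * ε))) atTop (𝓝 0) :=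
      Real.tendsto_exp_neg_atTop_nhds_zero.comp
        (tendsto_natCast_atTop_atTop.atTop_mul_const hε)
    exact h1.eventually_lt_const hr
  filter_upwards [hev, hexp, hsmall, eventually_gt_atTop 0] with n hn hnexp hnr hn0
  refine (measure_mono_ae ?_).trans hn
  filter_upwards [hupper] with ω hω hmem
  have hmem' : ε ≤ |(n : ℝ)⁻¹ * Real.log ‖∑ k ∈ Finset.range n, (z - ξ k ω)⁻¹‖| := hmem
  have hn' : (0 : ℝ) < n := by exact_mod_cast hn0
  change ‖∑ k ∈ Finset.range n, (z - ξ k ω)⁻¹‖ < r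
  set S := ‖∑ k ∈ Finset.range n, (z - ξ k ω)⁻¹‖ with hS
  rcases eq_or_lt_of_le (norm_nonneg (∑ k ∈ Finset.range n, (z - ξ k ω)⁻¹)) with h0 | h0
  · rwa [hS, ← h0]
  rw [abs_mul, abs_of_pos (inv_pos.2 hn'), le_inv_mul_iff₀ hn', le_abs] at hmem'
  rcases hmem' with h | h
  · have h1 := (Real.le_log_iff_exp_le h0).1 h
    exact absurd (h1.trans (hω n)) (not_le.2 hnexp)
  · have h1 := (Real.log_le_iff_le_exp h0).1 (by linarith : Real.log S ≤ -(n * ε))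
    exact h1.trans_lt hnr

/-- Joint convergence in measure, on the product of the probability space and the plane, of the
normalised logarithm of the logarithmic derivative. -/
theorem tendstoInMeasure_log_norm_sum_inv [IsProbabilityMeasure P]
    (hm : ∀ k, Measurable (ξ k)) (hind : iIndepFun ξ P)
    (hlaw : ∀ k, P.map (ξ k) =
      (1 / 2 : ℝ≥0∞) • Measure.dirac (a k) + (1 / 2 : ℝ≥0∞) • Measure.dirac (b k))
    (hab : {k : ℕ | a k ≠ b k}.Infinite) :
    TendstoInMeasure (P.prod (volume : Measure ℂ).toFinite)
      (fun (n : ℕ) (p : Ω × ℂ) =>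
        (n : ℝ)⁻¹ * Real.log ‖∑ k ∈ Finset.range n, (p.2 - ξ k p.1)⁻¹‖) atTop fun _ => 0 := by
  rw [tendstoInMeasure_iff_norm]
  intro ε hε
  simp only [sub_zero, Real.norm_eq_abs]
  have hmeas : ∀ n : ℕ, MeasurableSet {p : Ω × ℂ | ε ≤ |(n : ℝ)⁻¹ *
      Real.log ‖∑ k ∈ Finset.range n, (p.2 - ξ k p.1)⁻¹‖|} := by
    intro n
    have hS : Measurable fun p : Ω × ℂ => ∑ k ∈ Finset.range n, (p.2 - ξ k p.1)⁻¹ :=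
      Finset.measurable_sum _ fun k _ => (measurable_snd.sub ((hm k).comp measurable_fst)).inv
    have h : Measurable fun p : Ω × ℂ => |(n : ℝ)⁻¹ *
        Real.log ‖∑ k ∈ Finset.range n, (p.2 - ξ k p.1)⁻¹‖| := by fun_prop
    exact measurableSet_le measurable_const h
  simp only [Measure.prod_apply_symm (hmeas _)]
  have h := tendsto_lintegral_of_dominated_convergence (μ := (volume : Measure ℂ).toFinite)
    (F := fun (n : ℕ) (z : ℂ) => P {ω | ε ≤ |(n : ℝ)⁻¹ *
      Real.log ‖∑ k ∈ Finset.range n, (z - ξ k ω)⁻¹‖|}) (f := fun _ => 0) (fun _ => 1)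
    (fun n => measurable_measure_prodMk_right (hmeas n)) (fun n => ae_of_all _ fun z => prob_le_one)
    (by simp) ?_
  · simpa using h
  · rw [ae_toFinite]
    exact ae_tendsto_measure_le_abs_log_norm_sum_inv hm hind hlaw hab hε

/-! ### Convergence of the critical points -/

theorem logCesaroBounded_of_eq_or_eq {z : ℕ → ℂ} (ha : LogCesaroBounded a)
    (hb : LogCesaroBounded b) (hz : ∀ k, z k = a k ∨ z k = b k) : LogCesaroBounded z := by
  obtain ⟨Ca, hCa⟩ := ha
  obtain ⟨Cb, hCb⟩ := hb
  refine ⟨Ca + Cb, fun n => ?_⟩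
  have hle : ∑ k ∈ Finset.range n, Real.posLog ‖z k‖ ≤
      ∑ k ∈ Finset.range n, Real.posLog ‖a k‖ + ∑ k ∈ Finset.range n, Real.posLog ‖b k‖ := by
    rw [← Finset.sum_add_distrib]
    refine Finset.sum_le_sum fun k _ => ?_
    have h1 := @Real.posLog_nonneg ‖a k‖
    have h2 := @Real.posLog_nonneg ‖b k‖
    rcases hz k with h | h <;> rw [h] <;> linarith
  have h0 : 0 ≤ ∑ k ∈ Finset.range n, Real.posLog ‖z k‖ :=
    Finset.sum_nonneg fun k _ => Real.posLog_nonneg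
  rw [abs_of_nonneg (by positivity)]
  have h1 := (abs_le.1 (hCa n)).2
  have h2 := (abs_le.1 (hCb n)).2
  calc 1 / (n : ℝ) * ∑ k ∈ Finset.range n, Real.posLog ‖z k‖
      ≤ 1 / (n : ℝ) * (∑ k ∈ Finset.range n, Real.posLog ‖a k‖
        + ∑ k ∈ Finset.range n, Real.posLog ‖b k‖) := by gcongr
    _ ≤ Ca + Cb := by rw [mul_add]; linarith

/-- Every event defined by the random polynomial of degree `n`, without any regularity of the
condition, is measurable up to a null set: the first `n` variables almost surely take finitely many
values. -/
theorem exists_measurableSet_ae_eq_of_polyOfZeros (hm : ∀ k, Measurable (ξ k))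
    (hlaw : ∀ k, P.map (ξ k) =
      (1 / 2 : ℝ≥0∞) • Measure.dirac (a k) + (1 / 2 : ℝ≥0∞) • Measure.dirac (b k))
    (n : ℕ) (G : Set ℂ[X]) :
    ∃ E : Set Ω, MeasurableSet E ∧
      ∀ᵐ ω ∂P, ω ∈ E ↔ polyOfZeros (fun k => ξ k ω) n ∈ G := by
  set F : Set (Fin n → ℂ) := Set.pi Set.univ fun k => {a k, b k} with hF
  have hFfin : F.Finite := Set.Finite.pi fun k => Set.toFinite _
  set H : Set (Fin n → ℂ) := {v | v ∈ F ∧ (∏ k : Fin n, (X - C (v k))) ∈ G} with hH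
  have hX : Measurable fun ω (k : Fin n) => ξ k ω := measurable_pi_lambda _ fun k => hm k
  have hHm : MeasurableSet H := (hFfin.subset fun v hv => hv.1).measurableSet
  refine ⟨(fun ω (k : Fin n) => ξ k ω) ⁻¹' H, hX hHm, ?_⟩
  filter_upwards [ae_all_iff.2 fun k => ae_eq_or_eq_of_map_eq_half (hm k) (hlaw k)] with ω hω
  have hmem : (fun k : Fin n => ξ k ω) ∈ F := fun k _ => hω k
  rw [polyOfZeros, Finset.prod_range]
  exact ⟨fun h => h.2, fun h => ⟨hmem, h⟩⟩

end Bernoulli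

end CriticalPoints

theorem theorem2p3p2
    (μ : ProbabilityMeasure ℂ) (a b : ℕ → ℂ)
    (ha : CriticalPoints.IsDistributed μ a) (hb : CriticalPoints.IsDistributed μ b)
    (ha_log : CriticalPoints.LogCesaroBounded a) (hb_log : CriticalPoints.LogCesaroBounded b)
    (hab : {k : ℕ | a k ≠ b k}.Infinite)
    {Ω : Type*} [MeasurableSpace Ω] (P : Measure Ω) [IsProbabilityMeasure P]
    (ξ : ℕ → Ω → ℂ) (hξ_meas : ∀ k, Measurable (ξ k)) (hξ_indep : iIndepFun ξ P)
    (hξ_law : ∀ k, P.map (ξ k) =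
      (1 / 2 : ℝ≥0∞) • Measure.dirac (a k) + (1 / 2 : ℝ≥0∞) • Measure.dirac (b k)) :
    (∀ᵐ ω ∂P, Tendsto
      (fun n : ℕ => CriticalPoints.zeroMeasure
        (CriticalPoints.polyOfZeros (fun k => ξ k ω) n)) atTop (𝓝 μ)) ∧
    (∀ N ∈ 𝓝 μ, Tendsto
      (fun n : ℕ => P {ω | CriticalPoints.zeroMeasure
        (derivative (CriticalPoints.polyOfZeros (fun k => ξ k ω) n)) ∈ N}) atTop (𝓝 1)) := by
  have hdist := CriticalPoints.ae_isDistributed ha hb hξ_meas hξ_indep hξ_law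
  refine ⟨?_, fun N hN => ?_⟩
  · filter_upwards [hdist] with ω hω
    simp only [CriticalPoints.zeroMeasure_polyOfZeros]
    exact hω
  have hval := ae_all_iff.2 fun k =>
    CriticalPoints.ae_eq_or_eq_of_map_eq_half (hξ_meas k) (hξ_law k)
  -- measurable versions of the events, needed for the continuity of `P` along the subsequence
  choose E hEm hE using fun n : ℕ => CriticalPoints.exists_measurableSet_ae_eq_of_polyOfZeros
    hξ_meas hξ_law n {p | CriticalPoints.zeroMeasure (derivative p) ∈ N}
  refine tendsto_of_subseq_tendsto fun ns hns => ?_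
  obtain ⟨ms, hms, hae⟩ := ((CriticalPoints.tendstoInMeasure_log_norm_sum_inv hξ_meas hξ_indep
    hξ_law hab).comp hns).exists_seq_tendsto_ae
  refine ⟨ms, ?_⟩
  have hsub : Tendsto (fun j => ns (ms j)) atTop atTop := hns.comp hms.tendsto_atTop
  have hev : ∀ᵐ ω ∂P, ∀ᶠ j in atTop, ω ∈ E (ns (ms j)) ↔ ω ∈ Set.univ := by
    filter_upwards [Measure.ae_ae_of_ae_prod hae, hdist, hval, ae_all_iff.2 hE]
      with ω hω hωdist hωval hωE
    rw [ae_toFinite] at hω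
    have hlim := CriticalPoints.tendsto_zeroMeasure_derivative hωdist
      (CriticalPoints.logCesaroBounded_of_eq_or_eq ha_log hb_log hωval) hsub hω
    filter_upwards [hlim.eventually_mem hN] with j hj
    exact iff_of_true ((hωE _).2 hj) (Set.mem_univ ω)
  have hlim := tendsto_measure_of_ae_tendsto_indicator_of_isFiniteMeasure atTop MeasurableSet.univ
    (fun j => hEm (ns (ms j))) hev
  rw [measure_univ] at hlim
  refine hlim.congr fun j => measure_congr ?_
  filter_upwards [hE (ns (ms j))] with ω hω
  exact propext hω
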